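/- Let $\mathbb B=\{0,1\}$. A Boolean network of dimension $n$ is a function $f=(f_1,\dots,f_n):\mathbb B^n\to\mathbb B^n$; here each local function $f_i:\mathbb B^n\to\mathbb B$ is given by a propositional formula in the variables $x_1,\dots,x_n$ with the connectives $\neg,\wedge,\vee$. A sub-hypercube is a vector $h\in\{0,1,*\}^n$; its vertex set is $v(h)=\{x\in\mathbb B^n : x_i=h_i \text{ for all } i \text{ with } h_i\neq *\}$. It is a trap space of $f$ if $f(x)\in v(h)$ for all $x\in v(h)$, and a minimal trap space if moreover there is no trap space $h'$ of $f$ with $v(h')\subsetneq v(h)$. IN-MINTRAP is the following decision problem: given propositional formulas for the local functions $f_1,\dots,f_n$ of a Boolean network $f$ and a configuration $z\in\mathbb B^n$, decide whether $z$ is a vertex of some minimal trap space of $f$. **Theorem.** IN-MINTRAP is $\Pi_2^{\mathrm P}$-hard: every language $A$ in $\Pi_2^{\mathrm P}$ is reducible to IN-MINTRAP by a polynomial-time many-one reduction. Here a language $A$ over a finite alphabet is in $\Pi_2^{\mathrm P}$ if there are a polynomial-time decidable predicate $R$ and a polynomial $q$ such that $x\in A$ if and only if for every $u\in\{0,1\}^{q(|x|)}$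 there exists $v\in\{0,1\}^{q(|x|)}$ such that $R(x,u,v)$ holds. -/

import Mathlib

/-! ## The class `Π₂ᴾ`, polynomial-time many-one reductions and hardness

Polynomial-time computability is Mathlib's `Turing.TM2ComputableInPolyTime`: a finite Turing
machine, started on the encoding of the argument, halts with the encoding of the value after a
number of steps that is polynomially bounded in the length of the encoded argument. -/

namespace Complexity

open Computability Turing

/-- A triple (input, certificate, certificate) as one word: the three words one after the other,
each over its own copy of its alphabet. -/
def encodeTriple {Γ : Type} : List Γ × List Bool × List Bool → List (Γ ⊕ Bool ⊕ Bool)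
  | (x, u, v) => x.map Sum.inl ++ u.map (fun b => Sum.inr (Sum.inl b)) ++
      v.map (fun b => Sum.inr (Sum.inr b))

/-- `A ∈ Π₂ᴾ`: there are a polynomial-time decidable predicate `R` and a polynomial `q` such that
`x ∈ A` iff for all `u` of length `q(|x|)` there is `v` of length `q(|x|)` with `R (x, u, v)`. -/
def IsPi2P {Γ : Type} [Fintype Γ] (A : Language Γ) : Prop :=
  ∃ (R : List Γ × List Bool × List Bool → Bool) (q : Polynomial ℕ),
    Nonempty (TM2ComputableInPolyTime encodeTriple encodeBool R) ∧
    ∀ x : List Γ, x ∈ A ↔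
      ∀ u : List Bool, u.length = q.eval x.length →
        ∃ v : List Bool, v.length = q.eval x.length ∧ R (x, u, v) = true

/-- Polynomial-time many-one (Karp) reducibility of languages over finite alphabets. -/
def PolyTimeReducible {Γ Δ : Type} [Fintype Γ] [Fintype Δ] (A : Language Γ) (B : Language Δ) :
    Prop :=
  ∃ f : List Γ → List Δ,
    Nonempty (TM2ComputableInPolyTime (id : List Γ → List Γ) (id : List Δ → List Δ) f) ∧
    ∀ x : List Γ, x ∈ A ↔ f x ∈ B

/-- `B` is `Π₂ᴾ`-hard: every language in `Π₂ᴾ`, over any finite alphabet, reduces to `B` in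
polynomial time. -/
def IsPi2PHard {Δ : Type} [Fintype Δ] (B : Language Δ) : Prop :=
  ∀ (Γ : Type) [Fintype Γ] (A : Language Γ), IsPi2P A → PolyTimeReducible A B

end Complexity

/-! ## Boolean networks, sub-hypercubes and trap spaces -/

namespace BooleanNetwork

/-- The configurations of dimension `n`, i.e. `𝔹ⁿ`. -/
abbrev Config (n : ℕ) : Type := Fin n → Bool

/-- A sub-hypercube `h ∈ {0, 1, *}ⁿ`; `none` is the free value `*`. -/
abbrev Hypercube (n : ℕ) : Type := Fin n → Option Bool

/-- The vertex set `v(h)`. -/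
def Hypercube.vertices {n : ℕ} (h : Hypercube n) : Set (Config n) :=
  {x | ∀ i, h i ≠ none → h i = some (x i)}

/-- `h` is a trap space of `f`: it is closed by `f`. -/
def IsTrapSpace {n : ℕ} (f : Config n → Config n) (h : Hypercube n) : Prop :=
  ∀ x ∈ h.vertices, f x ∈ h.vertices

/-- `h` is a minimal trap space of `f`: no trap space is strictly smaller. -/
def IsMinimalTrapSpace {n : ℕ} (f : Config n → Config n) (h : Hypercube n) : Prop :=
  IsTrapSpace f h ∧ ¬ ∃ h' : Hypercube n, IsTrapSpace f h' ∧ h'.vertices ⊂ h.vertices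

/-- IN-MINTRAP(`f`, `z`): `z` is a vertex of a minimal trap space of `f`. -/
def InMinTrap {n : ℕ} (f : Config n → Config n) (z : Config n) : Prop :=
  ∃ h : Hypercube n, IsMinimalTrapSpace f h ∧ z ∈ h.vertices

/-! ## Propositional formulas and the encoding of instances -/

/-- Propositional formulas in the variables `x₁, …, xₙ` with the connectives `¬`, `∧`, `∨`. -/
inductive PropFormula (n : ℕ) : Type
  | var (i : Fin n) : PropFormula n
  | neg (φ : PropFormula n) : PropFormula n
  | and (φ ψ : PropFormula n) : PropFormula n
  | or (φ ψ : PropFormula n) : PropFormula n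

/-- The Boolean function represented by a formula. -/
def PropFormula.eval {n : ℕ} (x : Config n) : PropFormula n → Bool
  | var i => x i
  | neg φ => !(φ.eval x)
  | and φ ψ => φ.eval x && ψ.eval x
  | or φ ψ => φ.eval x || ψ.eval x

/-- The Boolean network whose local functions are given by the formulas `F 1, …, F n`. -/
def ofFormulas {n : ℕ} (F : Fin n → PropFormula n) : Config n → Config n :=
  fun x i => (F i).eval x

/-- The finite alphabet in which instances are written. -/
inductive Sym : Type
  | tick | var | neg | and | or
  | bit (b : Bool)
  deriving Fintype

/-- A formula as a word, in prefix notation. A variable is written as its index in unary; an index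
is smaller than the number of formulas in an instance, so unary or binary indices give lengths of
instances that are polynomially related. -/
def PropFormula.encode {n : ℕ} : PropFormula n → List Sym
  | var i => List.replicate i.val Sym.tick ++ [Sym.var]
  | neg φ => Sym.neg :: φ.encode
  | and φ ψ => Sym.and :: (φ.encode ++ ψ.encode)
  | or φ ψ => Sym.or :: (φ.encode ++ ψ.encode)

/-- An instance as a word: the `n` local formulas followed by the `n` bits of the configuration. -/
def encodeInstance {n : ℕ} (F : Fin n → PropFormula n) (z : Config n) : List Sym :=
  (List.ofFn F).flatMap PropFormula.encode ++ List.ofFn (fun i => Sym.bit (z i))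

/-- IN-MINTRAP, with local functions given as propositional formulas, as a language. -/
def inMinTrapLanguage : Language Sym :=
  {w | ∃ (n : ℕ) (F : Fin n → PropFormula n) (z : Config n),
    w = encodeInstance F z ∧ InMinTrap (ofFormulas F) z}

/-! The encoding is injective, so that membership of an encoded instance in the language only
depends on the instance. -/

theorem PropFormula.encode_append_inj {n : ℕ} (φ ψ : PropFormula n) (l l' : List Sym)
    (h : φ.encode ++ l = ψ.encode ++ l') : φ = ψ ∧ l = l' := by
  induction φ generalizing ψ l l' with
  | var i =>
    have key : ∀ (a b : ℕ), List.replicate a Sym.tick ++ Sym.var :: l =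
        List.replicate b Sym.tick ++ Sym.var :: l' → a = b ∧ l = l' := by
      intro a
      induction a with
      | zero => intro b hb; cases b <;> simp_all [List.replicate_succ]
      | succ a ih => intro b hb; cases b <;> simp_all [List.replicate_succ]
    cases ψ with
    | var j =>
      have := key i j (by simpa [encode] using h)
      exact ⟨by rw [Fin.ext this.1], this.2⟩
    | _ => obtain ⟨_ | i, hi⟩ := i <;> simp [encode, List.replicate_succ] at h
  | neg φ ih =>
    cases ψ with
    | var j => obtain ⟨_ | j, hj⟩ := j <;> simp [encode, List.replicate_succ] at h
    | neg ψ =>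
      have := ih ψ l l' (by simpa [encode] using h)
      exact ⟨by rw [this.1], this.2⟩
    | _ => simp [encode] at h
  | and φ₁ φ₂ ih₁ ih₂ =>
    cases ψ with
    | var j => obtain ⟨_ | j, hj⟩ := j <;> simp [encode, List.replicate_succ] at h
    | and ψ₁ ψ₂ =>
      have h₁ := ih₁ ψ₁ _ _ (by simpa [encode] using h)
      have h₂ := ih₂ ψ₂ _ _ h₁.2
      exact ⟨by rw [h₁.1, h₂.1], h₂.2⟩
    | _ => simp [encode] at h
  | or φ₁ φ₂ ih₁ ih₂ =>
    cases ψ with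
    | var j => obtain ⟨_ | j, hj⟩ := j <;> simp [encode, List.replicate_succ] at h
    | or ψ₁ ψ₂ =>
      have h₁ := ih₁ ψ₁ _ _ (by simpa [encode] using h)
      have h₂ := ih₂ ψ₂ _ _ h₁.2
      exact ⟨by rw [h₁.1, h₂.1], h₂.2⟩
    | _ => simp [encode] at h

theorem flatMap_encode_append_inj {n : ℕ} (L L' : List (PropFormula n)) (l l' : List Sym)
    (hlen : L.length = L'.length)
    (h : L.flatMap PropFormula.encode ++ l = L'.flatMap PropFormula.encode ++ l') :
    L = L' ∧ l = l' := by
  induction L generalizing L' with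
  | nil => cases L' <;> simp_all
  | cons φ L ih =>
    cases L' with
    | nil => simp at hlen
    | cons ψ L' =>
      have h₁ := PropFormula.encode_append_inj φ ψ (L.flatMap PropFormula.encode ++ l)
        (L'.flatMap PropFormula.encode ++ l') (by simpa using h)
      have h₂ := ih L' (by simpa using hlen) h₁.2
      exact ⟨by rw [h₁.1, h₂.1], h₂.2⟩

/-- Whether a symbol is a bit of the configuration. -/
def Sym.isBit : Sym → Bool
  | bit _ => true
  | _ => false

theorem countP_encodeInstance {n : ℕ} (F : Fin n → PropFormula n) (z : Config n) :
    (encodeInstance F z).countP Sym.isBit = n := by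
  have h₁ : ∀ φ : PropFormula n, φ.encode.countP Sym.isBit = 0 := by
    intro φ
    induction φ <;> simp_all [PropFormula.encode, Sym.isBit, List.countP_replicate]
  have h₂ : ∀ L : List (PropFormula n), (L.flatMap PropFormula.encode).countP Sym.isBit = 0 := by
    intro L
    induction L with
    | nil => rfl
    | cons φ L ih => rw [List.flatMap_cons, List.countP_append, h₁, ih]
  have h₃ : (List.ofFn (fun i => Sym.bit (z i))).countP Sym.isBit = n := by
    have : (List.ofFn (fun i => Sym.bit (z i))).countP Sym.isBit =
        (List.ofFn (fun i => Sym.bit (z i))).length := by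
      rw [List.countP_eq_length]
      intro a ha
      obtain ⟨i, rfl⟩ := (List.mem_ofFn' _ _).1 ha
      rfl
    rw [this, List.length_ofFn]
  rw [encodeInstance, List.countP_append, h₂, h₃, zero_add]

theorem encodeInstance_mem_iff {n : ℕ} (F : Fin n → PropFormula n) (z : Config n) :
    encodeInstance F z ∈ inMinTrapLanguage ↔ InMinTrap (ofFormulas F) z := by
  constructor
  · rintro ⟨m, F', z', h, hz⟩
    have hn : n = m := by
      rw [← countP_encodeInstance F z, h, countP_encodeInstance]
    subst hn
    obtain ⟨hF, hb⟩ := flatMap_encode_append_inj _ _ _ _ (by simp) h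
    have hF' := List.ofFn_injective hF
    have hz' : z = z' := by
      funext i
      simpa using congrFun (List.ofFn_injective hb) i
    subst hF' hz'
    exact hz
  · exact fun h => ⟨n, F, z, rfl, h⟩

end BooleanNetwork

namespace BooleanNetwork

/-! ## A network whose minimal trap spaces express a `∀∃` condition -/

/-! The network has a control `w`, a block `U` holding the universal certificate, and a remaining
block holding the existential certificate and a computation tableau. With `φ` the tableau formula,
its local functions are `¬w ∧ φ` on the control, `w ⊕ xᵢ` on `U`, and `¬xᵢ` on the rest.

A coordinate that is flipped at some vertex of a trap space must be free there, so the third block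
is always free. If a trap space has a vertex with `w = 1`, then the control and all of `U` are
flipped at it, and the trap space is the full cube. Every other trap space fixes `w = 0`. The cube
with `w = 0`, `U` fixed to `u` and the rest free is a trap space exactly when no vertex of it
satisfies `φ`. Conversely, a trap space with `w = 0` contains the whole fibre over the `U`-part of
any of its vertices, so it contains no vertex satisfying `φ`. Hence the full cube is minimal iff
every `u` extends to a model of `φ`. As the all-ones configuration has `w = 1`, the full cube is the
only trap space containing it. This is `inMinTrap_iff_forall_exists`.

The formula `φ` comes from a Cook–Levin argument for stack machines. Split into elementary
instructions, a computation changes stacks only at the top. If a row of the tableau lists the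
control and then, depth by depth, the symbols of all stacks, each new cell depends on the control
cell and three neighbouring cells (`StackTableau.exists_tableau`). The clauses force only that the
correct content of each cell is marked true. Superfluous marks do not matter, since a marked
rejecting content at the output cell is forbidden. This yields `Tableau.inMinTrap_iff`.

The map from inputs to instances must itself run on a Mathlib stack machine. A small loop language
is compiled to such machines (`StackProg.polyTime_of_run`). Words built from constants, unary
numbers and bounded iteration are shown writable in it in polynomial time (`polyTime_of_emit`), and
the instance is brought into that form (`Tableau.polyTime_instanceWord`). -/

theorem Hypercube.vertices_nonempty {n : ℕ} (h : Hypercube n) : h.vertices.Nonempty :=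
  ⟨fun i => (h i).getD false, fun i hi => by
    obtain ⟨b, hb⟩ := Option.ne_none_iff_exists'.1 hi
    simp [hb]⟩

theorem Hypercube.update_mem_vertices {n : ℕ} {h : Hypercube n} {x : Config n}
    (hx : x ∈ h.vertices) {i : Fin n} {b : Bool} (hb : h i = none ∨ h i = some b) :
    Function.update x i b ∈ h.vertices := by
  intro j hj
  rcases eq_or_ne j i with rfl | hne
  · rcases hb with hb | hb
    · exact absurd hb hj
    · simp [hb]
  · rw [Function.update_of_ne hne]
    exact hx j hj

/-- A fixed coordinate has the same value at a vertex and at its image, so a flip at one vertex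
rules out fixing. -/
theorem IsTrapSpace.eq_none_of_flip {n : ℕ} {f : Config n → Config n} {h : Hypercube n}
    (hf : IsTrapSpace f h) {x : Config n} (hx : x ∈ h.vertices) {i : Fin n}
    (hi : f x i = !(x i)) : h i = none := by
  by_contra hne
  have h₁ := hx i hne
  have h₂ := hf x hx i hne
  rw [h₁, hi] at h₂
  simp at h₂

/-- A network with a control `w`, coordinates in `U` that are preserved when the control is off and
flipped when it is on, and otherwise free coordinates. Its only minimal trap space containing a
configuration with the control on can be the full cube. -/
theorem inMinTrap_iff_forall_exists {n : ℕ} (f : Config n → Config n) (φ : Config n → Bool)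
    (w : Fin n) (U : Set (Fin n)) (hwU : w ∉ U)
    (hw : ∀ x, f x w = (!(x w) && φ x))
    (hU : ∀ x, ∀ i ∈ U, f x i = (x w ^^ x i))
    (hV : ∀ x i, i ≠ w → i ∉ U → f x i = !(x i)) (z : Config n) (hz : z w = true) :
    InMinTrap f z ↔ ∀ y : Config n, y w = false →
      ∃ y' : Config n, y' w = false ∧ (∀ i ∈ U, y' i = y i) ∧ φ y' = true := by
  classical
  have free : ∀ h : Hypercube n, IsTrapSpace f h → ∀ i, i ≠ w → i ∉ U → h i = none := by
    intro h hf i hi hi'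
    obtain ⟨x, hx⟩ := h.vertices_nonempty
    exact hf.eq_none_of_flip hx (hV x i hi hi')
  have full : ∀ h : Hypercube n, IsTrapSpace f h → h w ≠ some false → h = fun _ => none := by
    intro h hf hne
    obtain ⟨x, hx⟩ := h.vertices_nonempty
    -- Unless `w` is fixed to `0`, some vertex has the control on; there the control and every
    -- coordinate in `U` are flipped.
    have hx' : Function.update x w true ∈ h.vertices := by
      apply Hypercube.update_mem_vertices hx
      rcases hh : h w with _ | _ | _ <;> simp_all
    funext i
    rcases eq_or_ne i w with rfl | hi
    · exact hf.eq_none_of_flip hx' (by simp [hw])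
    by_cases hi' : i ∈ U
    · exact hf.eq_none_of_flip hx' (by simp [hU _ _ hi'])
    · exact free h hf i hi hi'
  have top : IsTrapSpace f (fun _ => none) := fun x _ i hi => absurd rfl hi
  constructor
  · rintro ⟨h, ⟨hf, hmin⟩, hzh⟩ y hy
    have hh : h = fun _ => none := by
      refine full h hf fun h' => ?_
      have := hzh w (by simp [h'])
      simp [h', hz] at this
    by_contra! hno
    -- If no extension of `y` satisfies `φ`, fixing the control to `0` and `U` to `y` gives a trap
    -- space. It is proper because it omits `z`.
    refine hmin ⟨fun i => if i = w then some false else if i ∈ U then some (y i) else none,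
      ?_, ?_⟩
    · intro x hx
      have hxw : x w = false := by simpa using (hx w (by simp)).symm
      have hxU : ∀ i ∈ U, x i = y i := by
        intro i hi
        have hne : i ≠ w := fun e => hwU (e ▸ hi)
        simpa [hne, hi] using (hx i (by simp [hne, hi])).symm
      intro i hi
      rcases eq_or_ne i w with rfl | hne
      · simp [hw, hno x hxw hxU]
      · by_cases hi' : i ∈ U
        · simp [hne, hi', hU x i hi', hxw, hxU i hi']
        · simp [hne, hi'] at hi
    · rw [hh]
      refine ⟨fun x _ i hi => absurd rfl hi, fun hsub => ?_⟩
      have := hsub (show z ∈ _ from fun i hi => absurd rfl hi) w (by simp)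
      simp [hz] at this
  · intro H
    refine ⟨fun _ => none, ⟨top, ?_⟩, fun i hi => absurd rfl hi⟩
    rintro ⟨h, hf, hlt⟩
    have hw0 : h w = some false := by
      by_contra hne
      rw [full h hf hne] at hlt
      exact lt_irrefl _ hlt
    obtain ⟨y, hy⟩ := h.vertices_nonempty
    have hyw : y w = false := by
      have := hy w (by simp [hw0])
      rw [hw0] at this
      simpa using this.symm
    obtain ⟨y', hy'w, hy'U, hφ⟩ := H y hyw
    -- `y'` differs from the vertex `y` only outside `U` and `w`, where `h` is free. Being a model
    -- of `φ`, it switches the control on and leaves `h`.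
    have hy' : y' ∈ h.vertices := by
      intro i hi
      rcases eq_or_ne i w with rfl | hne
      · rw [hw0, hy'w]
      · by_cases hi' : i ∈ U
        · rw [hy'U i hi']
          exact hy i hi
        · exact absurd (free h hf i hne hi') hi
    have := hf y' hy' w (by simp [hw0])
    rw [hw0, hw, hy'w, hφ] at this
    simp at this

/-! ## Formulas in variables indexed by natural numbers -/

/-- Propositional formulas in the variables `x₀, x₁, …`. -/
inductive Formula : Type
  | var (i : ℕ) : Formula
  | neg (φ : Formula) : Formula
  | and (φ ψ : Formula) : Formula
  | or (φ ψ : Formula) : Formula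

namespace Formula

/-- The truth value of a formula. -/
def eval (x : ℕ → Bool) : Formula → Bool
  | var i => x i
  | neg φ => !(φ.eval x)
  | and φ ψ => φ.eval x && ψ.eval x
  | or φ ψ => φ.eval x || ψ.eval x

/-- A formula as a word, in the same prefix notation as `PropFormula.encode`. -/
def encode : Formula → List Sym
  | var i => List.replicate i Sym.tick ++ [Sym.var]
  | neg φ => Sym.neg :: φ.encode
  | and φ ψ => Sym.and :: (φ.encode ++ ψ.encode)
  | or φ ψ => Sym.or :: (φ.encode ++ ψ.encode)

/-- All variables of the formula have an index below `n`. -/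
def VarsLt (n : ℕ) : Formula → Prop
  | var i => i < n
  | neg φ => φ.VarsLt n
  | and φ ψ => φ.VarsLt n ∧ ψ.VarsLt n
  | or φ ψ => φ.VarsLt n ∧ ψ.VarsLt n

/-- The formula as a formula in `n` variables, with indices taken modulo `n`. -/
def toProp (n : ℕ) [NeZero n] : Formula → PropFormula n
  | var i => .var (Fin.ofNat n i)
  | neg φ => .neg (φ.toProp n)
  | and φ ψ => .and (φ.toProp n) (ψ.toProp n)
  | or φ ψ => .or (φ.toProp n) (ψ.toProp n)

/-- Reduction modulo `n` does nothing to indices below `n`, so the word of a formula can be produced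
without reference to the dimension. -/
theorem encode_toProp {n : ℕ} [NeZero n] {φ : Formula} (h : φ.VarsLt n) :
    (φ.toProp n).encode = φ.encode := by
  induction φ with
  | var i => simp [toProp, PropFormula.encode, encode, Nat.mod_eq_of_lt (show i < n from h)]
  | neg φ ih => simp [toProp, PropFormula.encode, encode, ih h]
  | and φ ψ ih₁ ih₂ | or φ ψ ih₁ ih₂ =>
    simp [toProp, PropFormula.encode, encode, ih₁ h.1, ih₂ h.2]

theorem eval_toProp {n : ℕ} [NeZero n] (φ : Formula) (x : Config n) :
    (φ.toProp n).eval x = φ.eval (fun i => x (Fin.ofNat n i)) := by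
  induction φ <;> simp_all [toProp, PropFormula.eval, eval]

/-- A formula that is always true. -/
def verum : Formula := or (var 0) (neg (var 0))

/-- The implication `φ → ψ`. -/
def imp (φ ψ : Formula) : Formula := or (neg φ) ψ

/-- The exclusive disjunction of two formulas. -/
def xor (φ ψ : Formula) : Formula := or (and φ (neg ψ)) (and (neg φ) ψ)

/-- The conjunction of a list of formulas. -/
def conj (L : List Formula) : Formula := L.foldr and verum

@[simp] theorem eval_verum (x : ℕ → Bool) : verum.eval x = true := by simp [verum, eval]

@[simp] theorem eval_imp (x : ℕ → Bool) (φ ψ : Formula) :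
    (imp φ ψ).eval x = true ↔ (φ.eval x = true → ψ.eval x = true) := by
  simp only [imp, eval]
  cases φ.eval x <;> cases ψ.eval x <;> simp

@[simp] theorem eval_xor (x : ℕ → Bool) (φ ψ : Formula) :
    (xor φ ψ).eval x = (φ.eval x ^^ ψ.eval x) := by
  simp only [xor, eval]
  cases φ.eval x <;> cases ψ.eval x <;> rfl

theorem eval_conj (x : ℕ → Bool) (L : List Formula) :
    (conj L).eval x = true ↔ ∀ φ ∈ L, φ.eval x = true := by
  induction L with
  | nil => simp [conj]
  | cons φ L ih => simpa [conj, eval] using fun _ => ih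

/-- In prefix notation a right-nested conjunction is a plain sequence of clauses, each preceded by
`and`; clauses can therefore be written one at a time, with `verum` closing the word. -/
theorem encode_conj (L : List Formula) :
    (conj L).encode = L.flatMap (fun φ => Sym.and :: φ.encode) ++ verum.encode := by
  induction L with
  | nil => rfl
  | cons φ L ih =>
    rw [List.flatMap_cons, List.append_assoc, ← ih]
    simp [conj, encode]

theorem varsLt_conj {n : ℕ} (hn : 0 < n) {L : List Formula} (h : ∀ φ ∈ L, φ.VarsLt n) :
    (conj L).VarsLt n := by
  induction L with
  | nil => exact ⟨hn, hn⟩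
  | cons φ L ih =>
    simp only [List.mem_cons, forall_eq_or_imp] at h
    exact ⟨h.1, ih h.2⟩

end Formula

end BooleanNetwork

/-! ### Initial and final configurations of stack machines -/

open Turing

/-- Splitting on `k = tm.k₀` removes the cast in the stacks, leaving an updated empty family that
can be compared with the stacks of a program. -/
theorem Turing.initList_eq (tm : FinTM2) (s : List (tm.Γ tm.k₀)) :
    initList tm s =
      ⟨some tm.main, tm.initialState, Function.update (fun _ => []) tm.k₀ s⟩ := by
  unfold initList
  congr 1
  funext k
  by_cases hk : k = tm.k₀
  · subst hk
    simp
  · simp [hk]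

theorem Turing.haltList_eq (tm : FinTM2) (s : List (tm.Γ tm.k₁)) :
    haltList tm s = ⟨none, tm.initialState, Function.update (fun _ => []) tm.k₁ s⟩ := by
  unfold haltList
  congr 1
  funext k
  by_cases hk : k = tm.k₁
  · subst hk
    simp
  · simp [hk]

/-! ## A small programming language for stack machines -/

/-- Programs over a family of stacks. -/
inductive StackProg {K : Type} (A : K → Type) : Type
  | skip : StackProg A
  | push (k : K) (a : A k) : StackProg A
  | seq (p q : StackProg A) : StackProg A
  | whilePop (k : K) (body : A k → StackProg A) : StackProg A

namespace StackProg

variable {K : Type} {A : K → Type}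

/-- `Run p S t S'`: the program `p` started with stacks `S` ends after `t` steps with stacks `S'`.
The loop `whilePop k body` pops symbols from the stack `k` and executes the corresponding body,
until the stack is empty. -/
inductive Run [DecidableEq K] : StackProg A → (∀ k, List (A k)) → ℕ → (∀ k, List (A k)) → Prop
  | skip (S : ∀ k, List (A k)) : Run skip S 1 S
  | push (k : K) (a : A k) (S : ∀ k, List (A k)) :
      Run (push k a) S 1 (Function.update S k (a :: S k))
  | seq {p q : StackProg A} {S S' S'' : ∀ k, List (A k)} {t t' : ℕ} (h : Run p S t S')
      (h' : Run q S' t' S'') : Run (seq p q) S (t + t') S''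
  | whilePop_nil {k : K} (body : A k → StackProg A) {S : ∀ k, List (A k)} (h : S k = []) :
      Run (whilePop k body) S 1 S
  | whilePop_cons {k : K} {body : A k → StackProg A} {S S' S'' : ∀ k, List (A k)} {a : A k}
      {l : List (A k)} {t t' : ℕ} (hk : S k = a :: l)
      (h : Run (body a) (Function.update S k l) t S') (h' : Run (whilePop k body) S' t' S'') :
      Run (whilePop k body) S (1 + t + t') S''

/-- The program points of a program. -/
def Label : StackProg A → Type
  | skip => Unit
  | push _ _ => Unit
  | seq p q => p.Label ⊕ q.Label
  | whilePop k body => Option (Σ a : A k, (body a).Label)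

/-- The first program point. -/
def entry : (p : StackProg A) → p.Label
  | skip => ()
  | push _ _ => ()
  | seq p _ => Sum.inl p.entry
  | whilePop _ _ => none

theorem finite_label [∀ k, Finite (A k)] (p : StackProg A) : Finite p.Label := by
  induction p with
  | skip => exact inferInstanceAs (Finite Unit)
  | push => exact inferInstanceAs (Finite Unit)
  | seq p q ih₁ ih₂ => exact inferInstanceAs (Finite (p.Label ⊕ q.Label))
  | whilePop k body ih => exact inferInstanceAs (Finite (Option (Σ a : A k, (body a).Label)))

/-- The statement of the compiled program at a program point: program points are named through
`emb`, and the control leaves the program to `exit`. -/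
def code [DecidableEq K] {Λ : Type} : (p : StackProg A) → (p.Label → Λ) → Λ → p.Label →
    TM2.Stmt A Λ (Option (Σ k, A k))
  | skip, _, exit, _ => .goto fun _ => exit
  | push k a, _, exit, _ => .push k (fun _ => a) (.goto fun _ => exit)
  | seq p q, emb, _, Sum.inl l => p.code (fun l => emb (Sum.inl l)) (emb (Sum.inr q.entry)) l
  | seq _ q, emb, exit, Sum.inr l => q.code (fun l => emb (Sum.inr l)) exit l
  | whilePop k body, emb, exit, none =>
      .pop k (fun _ o => o.map (Sigma.mk k)) (.goto fun s =>
        match s with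
        | none => exit
        | some ⟨k', a⟩ => if h : k' = k then emb (some ⟨h ▸ a, (body (h ▸ a)).entry⟩) else exit)
  | whilePop _ body, emb, _, some ⟨a, l⟩ =>
      (body a).code (fun l => emb (some ⟨a, l⟩)) (emb none) l

/-- A compiled program simulates the program step by step. -/
theorem Run.iterate_step [DecidableEq K] {Λ : Type} {M : Λ → TM2.Stmt A Λ (Option (Σ k, A k))}
    {p : StackProg A} {S S' : ∀ k, List (A k)} {t : ℕ} (h : Run p S t S') (emb : p.Label → Λ)
    (exit : Λ) (hM : ∀ l, M (emb l) = p.code emb exit l) (v : Option (Σ k, A k)) :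
    ∃ v', (flip bind (TM2.step M))^[t] (some ⟨some (emb p.entry), v, S⟩) =
      some ⟨some exit, v', S'⟩ := by
  induction h generalizing v exit with
  | skip S => exact ⟨v, by simp [flip, hM, code]⟩
  | push k a S => exact ⟨v, by simp [flip, hM, code]⟩
  | @seq p q S S' S'' t t' h h' ih ih' =>
    obtain ⟨v₁, h₁⟩ := ih (fun l => emb (Sum.inl l)) (emb (Sum.inr q.entry))
      (fun l => hM (Sum.inl l)) v
    obtain ⟨v₂, h₂⟩ := ih' (fun l => emb (Sum.inr l)) exit (fun l => hM (Sum.inr l)) v₁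
    refine ⟨v₂, ?_⟩
    rw [Nat.add_comm, Function.iterate_add_apply]
    exact (congrArg _ h₁).trans h₂
  | @whilePop_nil k body S hk =>
    refine ⟨none, ?_⟩
    have hU : Function.update S k [] = S := by rw [← hk, Function.update_eq_self]
    have h₀ : M (emb none) = (whilePop k body).code emb exit none := hM none
    simp [flip, h₀, code, entry, hk, hU]
  | @whilePop_cons k body S S' S'' a l t t' hk h h' ih ih' =>
    -- The popped symbol is kept in the internal state, which selects the copy of the body to enter;
    -- the exit of that copy is the head of the loop.
    obtain ⟨v₁, h₁⟩ := ih (fun l => emb (some ⟨a, l⟩)) (emb none) (fun l => hM (some ⟨a, l⟩))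
      (some ⟨k, a⟩)
    obtain ⟨v₂, h₂⟩ := ih' emb exit hM v₁
    refine ⟨v₂, ?_⟩
    have h₀ : (flip bind (TM2.step M))^[1]
        (some ⟨some (emb (whilePop k body).entry), v, S⟩) =
        some ⟨some (emb (some ⟨a, (body a).entry⟩)), some ⟨k, a⟩, Function.update S k l⟩ := by
      have h₀ : M (emb none) = (whilePop k body).code emb exit none := hM none
      simp [flip, h₀, code, entry, hk]
    rw [show 1 + t + t' = t' + (t + 1) by omega, Function.iterate_add_apply,
      Function.iterate_add_apply, h₀, h₁]
    exact h₂

/-- The machine that executes a program, with input stack `k₀` and output stack `k₁`. -/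
noncomputable def machine [DecidableEq K] [Fintype K] [∀ k, Fintype (A k)] (p : StackProg A) (k₀ k₁ : K) :
    FinTM2 where
  K := K
  k₀ := k₀
  k₁ := k₁
  Γ := A
  Λ := Option p.Label
  main := some p.entry
  ΛFin := @Fintype.ofFinite _ (@instFiniteOption _ p.finite_label)
  σ := Option (Σ k, A k)
  initialState := none
  m
    | none => .load (fun _ => none) .halt
    | some l => p.code some none l

/-- A program that transforms the stacks `f₀ a` with only the input to the stacks with only the
output in polynomial time gives a function computable in polynomial time. -/
theorem polyTime_of_run [DecidableEq K] [Fintype K] [∀ k, Fintype (A k)] (p : StackProg A) (k₀ k₁ : K)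
    (f : List (A k₀) → List (A k₁)) (c : Polynomial ℕ)
    (h : ∀ x, ∃ t ≤ c.eval x.length, Run p (Function.update (fun _ => []) k₀ x) t
      (Function.update (fun _ => []) k₁ (f x))) :
    Nonempty (TM2ComputableInPolyTime (id : List (A k₀) → List (A k₀))
      (id : List (A k₁) → List (A k₁)) f) := by
  refine ⟨⟨⟨p.machine k₀ k₁, Equiv.refl _, Equiv.refl _⟩, c + 1, fun x => ?_⟩⟩
  have key : ∀ (x' : List (A k₀)) (y' : List (A k₁)), x' = x → y' = f x → ∃ t ≤ c.eval x.length, (flip bind (p.machine k₀ k₁).step)^[t + 1]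
      (some (initList (p.machine k₀ k₁) x')) = some (haltList (p.machine k₀ k₁) y') := by
    rintro x' y' rfl rfl
    obtain ⟨t, ht, hrun⟩ := h x'
    refine ⟨t, ht, ?_⟩
    obtain ⟨v, hv⟩ := hrun.iterate_step (M := (p.machine k₀ k₁).m) some none (fun l => rfl) none
    have e₀ := initList_eq (p.machine k₀ k₁) x'
    have e₁ := haltList_eq (p.machine k₀ k₁) (f x')
    -- The extra step is the one at the label `none`: it resets the internal state, as a final
    -- configuration requires.
    rw [Function.iterate_succ_apply', e₀, e₁]
    refine (congrArg (flip bind _) hv).trans ?_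
    rfl
  -- The number of steps is data in the machine's running-time certificate, so it must be chosen
  -- from an existence statement.
  have key' := Classical.indefiniteDescription _ (key _ _ (List.map_id x) (List.map_id (f x)))
  refine ⟨⟨key'.1 + 1, ?_⟩, ?_⟩
  · exact key'.2.2
  · simpa using key'.2.1

end StackProg

/-! ## Programs that write words -/

namespace StackProg

/-- The stacks of a word-writing program: input, output, the word under construction, a scratch
counter, and `D` registers with as many loop counters. -/
inductive Reg (D : ℕ) : Type
  | inp | out | word | scr
  | val (i : Fin D)
  | cnt (i : Fin D)
  deriving DecidableEq, Fintype

/-- The alphabets of the stacks; the counters are written in unary. -/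
abbrev RegAlphabet (Γ Δ : Type) {D : ℕ} : Reg D → Type
  | .inp => Γ
  | .out => Δ
  | .word => Δ
  | .scr => Unit
  | .val _ => Unit
  | .cnt _ => Unit

instance {Γ Δ : Type} [Fintype Γ] [Fintype Δ] {D : ℕ} (k : Reg D) :
    Fintype (RegAlphabet Γ Δ k) := by
  cases k <;> infer_instance

/-- Readable descriptions of the contents of the stacks. -/
@[ext] structure Mem (Γ Δ : Type) where
  /-- the input stack -/
  inp : List Γ := []
  /-- the output stack -/
  out : List Δ := []
  /-- the word under construction, last symbol first -/
  word : List Δ := []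
  /-- the scratch counter -/
  scr : ℕ := 0
  /-- the registers -/
  val : ℕ → ℕ := fun _ => 0
  /-- the loop counters -/
  cnt : ℕ → ℕ := fun _ => 0

namespace Mem

variable {Γ Δ : Type}

/-- The stacks described by a memory. -/
def stk {D : ℕ} (s : Mem Γ Δ) : ∀ k : Reg D, List (RegAlphabet Γ Δ k)
  | .inp => s.inp
  | .out => s.out
  | .word => s.word
  | .scr => List.replicate s.scr ()
  | .val i => List.replicate (s.val i) ()
  | .cnt i => List.replicate (s.cnt i) ()

variable {D : ℕ} (s : Mem Γ Δ)

theorem update_inp (l : List Γ) :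
    Function.update (s.stk (D := D)) .inp l = ({s with inp := l} : Mem Γ Δ).stk := by
  funext k; cases k <;> rfl

theorem update_out (l : List Δ) :
    Function.update (s.stk (D := D)) .out l = ({s with out := l} : Mem Γ Δ).stk := by
  funext k; cases k <;> rfl

theorem update_word (l : List Δ) :
    Function.update (s.stk (D := D)) .word l = ({s with word := l} : Mem Γ Δ).stk := by
  funext k; cases k <;> rfl

theorem update_scr (m : ℕ) :
    Function.update (s.stk (D := D)) .scr (List.replicate m ()) =
      ({s with scr := m} : Mem Γ Δ).stk := by
  funext k; cases k <;> rfl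

theorem update_val (i : Fin D) (m : ℕ) :
    Function.update (s.stk (D := D)) (.val i) (List.replicate m ()) =
      ({s with val := Function.update s.val i m} : Mem Γ Δ).stk := by
  funext k
  cases k with
  | val j =>
    rcases eq_or_ne j i with rfl | h
    · simp [stk]
    · rw [Function.update_of_ne (by simpa using h)]
      simp only [stk]
      rw [Function.update_of_ne (by simpa [Fin.ext_iff] using h)]
  | _ => rfl

theorem update_cnt (i : Fin D) (m : ℕ) :
    Function.update (s.stk (D := D)) (.cnt i) (List.replicate m ()) =
      ({s with cnt := Function.update s.cnt i m} : Mem Γ Δ).stk := by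
  funext k
  cases k with
  | cnt j =>
    rcases eq_or_ne j i with rfl | h
    · simp [stk]
    · rw [Function.update_of_ne (by simpa using h)]
      simp only [stk]
      rw [Function.update_of_ne (by simpa [Fin.ext_iff] using h)]
  | _ => rfl

/-- Write a word: to the word under construction, or only its length to a loop counter. -/
def emit (τ : Option (Fin D)) (L : List Δ) : Mem Γ Δ :=
  match τ with
  | none => {s with word := L.reverse ++ s.word}
  | some i => {s with cnt := Function.update s.cnt i (s.cnt i + L.length)}

@[simp] theorem emit_nil (τ : Option (Fin D)) : s.emit τ [] = s := by
  cases τ <;> simp [emit]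

theorem emit_append (τ : Option (Fin D)) (L L' : List Δ) :
    s.emit τ (L ++ L') = (s.emit τ L).emit τ L' := by
  cases τ <;> simp [emit, add_assoc]

@[simp] theorem emit_val (τ : Option (Fin D)) (L : List Δ) : (s.emit τ L).val = s.val := by
  cases τ <;> rfl

@[simp] theorem emit_scr (τ : Option (Fin D)) (L : List Δ) : (s.emit τ L).scr = s.scr := by
  cases τ <;> rfl

theorem emit_cnt (τ : Option (Fin D)) (L : List Δ) {j : ℕ} (h : ∀ i, τ = some i → (i : ℕ) ≠ j) :
    (s.emit τ L).cnt j = s.cnt j := by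
  cases τ with
  | none => rfl
  | some i => exact Function.update_of_ne (h i rfl).symm _ _

end Mem

variable {Γ Δ : Type} {D : ℕ}

theorem run_push_word (s : Mem Γ Δ) (a : Δ) :
    Run (push (A := RegAlphabet Γ Δ (D := D)) .word a) s.stk 1
      ({s with word := a :: s.word} : Mem Γ Δ).stk := by
  rw [← s.update_word (a :: s.word)]; exact Run.push (A := RegAlphabet Γ Δ (D := D)) .word a s.stk

theorem run_push_out (s : Mem Γ Δ) (a : Δ) :
    Run (push (A := RegAlphabet Γ Δ (D := D)) .out a) s.stk 1
      ({s with out := a :: s.out} : Mem Γ Δ).stk := by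
  rw [← s.update_out (a :: s.out)]; exact Run.push (A := RegAlphabet Γ Δ (D := D)) .out a s.stk

theorem run_push_scr (s : Mem Γ Δ) :
    Run (push (A := RegAlphabet Γ Δ (D := D)) .scr ()) s.stk 1
      ({s with scr := s.scr + 1} : Mem Γ Δ).stk := by
  rw [← s.update_scr (s.scr + 1)]; exact Run.push (A := RegAlphabet Γ Δ (D := D)) .scr () s.stk

theorem run_push_val (s : Mem Γ Δ) (i : Fin D) :
    Run (push (A := RegAlphabet Γ Δ (D := D)) (.val i) ()) s.stk 1
      ({s with val := Function.update s.val i (s.val i + 1)} : Mem Γ Δ).stk := by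
  rw [← s.update_val i (s.val i + 1)]; exact Run.push (A := RegAlphabet Γ Δ (D := D)) (.val i) () s.stk

theorem run_push_cnt (s : Mem Γ Δ) (i : Fin D) :
    Run (push (A := RegAlphabet Γ Δ (D := D)) (.cnt i) ()) s.stk 1
      ({s with cnt := Function.update s.cnt i (s.cnt i + 1)} : Mem Γ Δ).stk := by
  rw [← s.update_cnt i (s.cnt i + 1)]; exact Run.push (A := RegAlphabet Γ Δ (D := D)) (.cnt i) () s.stk

/-- Write one symbol to the target. -/
def emitSym (τ : Option (Fin D)) (a : Δ) : StackProg (RegAlphabet Γ Δ (D := D)) :=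
  match τ with
  | none => push .word a
  | some i => push (.cnt i) ()

theorem run_emitSym (s : Mem Γ Δ) (τ : Option (Fin D)) (a : Δ) :
    Run (emitSym (Γ := Γ) τ a) s.stk 1 (s.emit τ [a]).stk := by
  cases τ with
  | none => exact run_push_word s a
  | some i => exact run_push_cnt s i

/-- The registers and loop counters from `d` on, and the scratch counter, are zero. -/
def Mem.Clean (s : Mem Γ Δ) (d : ℕ) : Prop :=
  s.scr = 0 ∧ ∀ i, d ≤ i → s.val i = 0 ∧ s.cnt i = 0

/-- A program with `D` registers that uses only the registers from `d` on for intermediate results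
writes the word `g ρ`, where `ρ` are the values of the registers, in polynomial time. -/
def EmitAt (Γ : Type) (D d : ℕ) (g : (ℕ → ℕ) → List Δ) : Prop :=
  ∃ (p : Option (Fin D) → StackProg (RegAlphabet Γ Δ (D := D))) (c : Polynomial ℕ),
    ∀ (τ : Option (Fin D)) (s : Mem Γ Δ) (M : ℕ), (∀ i, τ = some i → (i : ℕ) < d) → s.Clean d →
      (∀ i, s.val i ≤ M) → (g s.val).length ≤ c.eval M ∧
        ∃ t ≤ c.eval M, Run (p τ) s.stk t (s.emit τ (g s.val)).stk

theorem emitAt_nil (d : ℕ) : EmitAt Γ D d (fun _ => ([] : List Δ)) :=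
  ⟨fun _ => skip, 1, fun τ s M _ _ _ => ⟨by simp, 1, by simp, by
    rw [Mem.emit_nil]
    exact Run.skip _⟩⟩

theorem emitAt_singleton (d : ℕ) (a : Δ) : EmitAt Γ D d (fun _ => [a]) :=
  ⟨fun τ => emitSym τ a, 1, fun τ s M _ _ _ => ⟨by simp, 1, by simp, run_emitSym s τ a⟩⟩

theorem EmitAt.append {d : ℕ} {g g' : (ℕ → ℕ) → List Δ} (h : EmitAt Γ D d g)
    (h' : EmitAt Γ D d g') : EmitAt Γ D d (fun ρ => g ρ ++ g' ρ) := by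
  obtain ⟨p, c, hp⟩ := h
  obtain ⟨p', c', hp'⟩ := h'
  refine ⟨fun τ => seq (p τ) (p' τ), c + c', fun τ s M hτ hs hM => ?_⟩
  obtain ⟨hl, t, ht, hr⟩ := hp τ s M hτ hs hM
  have hs' : (s.emit τ (g s.val)).Clean d := by
    refine ⟨by simpa using hs.1, fun i hi => ⟨by simpa using (hs.2 i hi).1, ?_⟩⟩
    rw [Mem.emit_cnt]
    · exact (hs.2 i hi).2
    · exact fun j hj => ((hτ j hj).trans_le hi).ne
  obtain ⟨hl', t', ht', hr'⟩ := hp' τ (s.emit τ (g s.val)) M hτ hs' (by simpa using hM)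
  rw [Mem.emit_val] at hl' hr'
  refine ⟨?_, t + t', ?_, ?_⟩
  · simpa using Nat.add_le_add hl hl'
  · simpa using Nat.add_le_add ht ht'
  · rw [Mem.emit_append]
    exact Run.seq hr hr'

theorem emitAt_const (d : ℕ) (L : List Δ) : EmitAt Γ D d (fun _ => L) := by
  induction L with
  | nil => exact emitAt_nil d
  | cons a L ih => exact (emitAt_singleton d a).append ih

theorem run_whilePop_val_cons {s s' s'' : Mem Γ Δ} {i : Fin D} {m t t' : ℕ}
    {body : Unit → StackProg (RegAlphabet Γ Δ (D := D))} (hm : s.val i = m + 1)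
    (h : Run (body ()) ({s with val := Function.update s.val i m} : Mem Γ Δ).stk t s'.stk)
    (h' : Run (whilePop (.val i) body) s'.stk t' s''.stk) :
    Run (whilePop (.val i) body) s.stk (1 + t + t') s''.stk := by
  refine Run.whilePop_cons (a := ()) (l := List.replicate m ()) ?_ ?_ h'
  · simp only [Mem.stk]
    rw [hm, List.replicate_succ]
  · rw [Mem.update_val]
    exact h

theorem run_whilePop_cnt_cons {s s' s'' : Mem Γ Δ} {i : Fin D} {m t t' : ℕ}
    {body : Unit → StackProg (RegAlphabet Γ Δ (D := D))} (hm : s.cnt i = m + 1)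
    (h : Run (body ()) ({s with cnt := Function.update s.cnt i m} : Mem Γ Δ).stk t s'.stk)
    (h' : Run (whilePop (.cnt i) body) s'.stk t' s''.stk) :
    Run (whilePop (.cnt i) body) s.stk (1 + t + t') s''.stk := by
  refine Run.whilePop_cons (a := ()) (l := List.replicate m ()) ?_ ?_ h'
  · simp only [Mem.stk]
    rw [hm, List.replicate_succ]
  · rw [Mem.update_cnt]
    exact h

theorem run_whilePop_scr_cons {s s' s'' : Mem Γ Δ} {m t t' : ℕ}
    {body : Unit → StackProg (RegAlphabet Γ Δ (D := D))} (hm : s.scr = m + 1)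
    (h : Run (body ()) ({s with scr := m} : Mem Γ Δ).stk t s'.stk)
    (h' : Run (whilePop .scr body) s'.stk t' s''.stk) :
    Run (whilePop .scr body) s.stk (1 + t + t') s''.stk := by
  refine Run.whilePop_cons (a := ()) (l := List.replicate m ()) ?_ ?_ h'
  · simp only [Mem.stk]
    rw [hm, List.replicate_succ]
  · rw [Mem.update_scr]
    exact h

/-- Each round costs one pop and one `skip`, and the final test for emptiness costs one step. -/
theorem run_clear_val (s : Mem Γ Δ) (i : Fin D) :
    Run (whilePop (A := RegAlphabet Γ Δ (D := D)) (.val i) fun _ => skip) s.stk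
      (2 * s.val i + 1) ({s with val := Function.update s.val i 0} : Mem Γ Δ).stk := by
  generalize hm : s.val i = m
  induction m generalizing s with
  | zero =>
    rw [← hm, Function.update_eq_self, hm]
    exact Run.whilePop_nil _ (by simp [Mem.stk, hm])
  | succ m ih =>
    have := ih {s with val := Function.update s.val i m} (by simp)
    simp only [Function.update_idem] at this
    convert run_whilePop_val_cons hm (Run.skip _) this using 1
    omega

theorem run_restore_val (s : Mem Γ Δ) (i : Fin D) :
    Run (whilePop (A := RegAlphabet Γ Δ (D := D)) .scr fun _ => push (.val i) ()) s.stk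
      (2 * s.scr + 1)
      ({s with val := Function.update s.val i (s.val i + s.scr), scr := 0} : Mem Γ Δ).stk := by
  generalize hm : s.scr = m
  induction m generalizing s with
  | zero =>
    have e : ({s with val := Function.update s.val i (s.val i + 0), scr := 0} : Mem Γ Δ) = s := by
      ext1 <;> simp [hm]
    rw [e]
    exact Run.whilePop_nil _ (by simp [Mem.stk, hm])
  | succ m ih =>
    have h₁ := run_push_val (D := D) {s with scr := m} i
    have h₂ := ih _ (rfl : ({s with scr := m, val := Function.update s.val i (s.val i + 1)} :
      Mem Γ Δ).scr = m)
    simp only [Function.update_idem, Function.update_self, add_assoc, add_comm 1 m] at h₂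
    convert run_whilePop_scr_cons hm h₁ h₂ using 1
    omega

/-- Reading a register destroys it, so every unit popped is also saved on the scratch counter;
`run_restore_val` moves it back. -/
theorem run_drain_val (s : Mem Γ Δ) (i : Fin D) (τ : Option (Fin D)) (a : Δ) :
    Run (whilePop (A := RegAlphabet Γ Δ (D := D)) (.val i)
        fun _ => seq (emitSym τ a) (push .scr ())) s.stk (3 * s.val i + 1)
      (({s with val := Function.update s.val i 0, scr := s.scr + s.val i} : Mem Γ Δ).emit τ
        (List.replicate (s.val i) a)).stk := by
  generalize hm : s.val i = m
  induction m generalizing s with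
  | zero =>
    have e : ({s with val := Function.update s.val i 0, scr := s.scr + 0} : Mem Γ Δ) = s := by
      ext1 <;> simp [← hm]
    rw [e, List.replicate_zero, Mem.emit_nil]
    exact Run.whilePop_nil _ (by simp [Mem.stk, hm])
  | succ m ih =>
    have h₁ := run_emitSym (D := D) {s with val := Function.update s.val i m} τ a
    have h₂ := run_push_scr (D := D) (({s with val := Function.update s.val i m} : Mem Γ Δ).emit τ [a])
    have h₃ := ih {({s with val := Function.update s.val i m} : Mem Γ Δ).emit τ [a] with
      scr := (({s with val := Function.update s.val i m} : Mem Γ Δ).emit τ [a]).scr + 1} (by simp)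
    convert run_whilePop_val_cons hm (Run.seq h₁ h₂) h₃ using 1
    · omega
    · rw [List.replicate_succ, ← List.singleton_append, Mem.emit_append]
      congr 1
      cases τ <;> ext1 <;> simp [Mem.emit, add_assoc, add_comm 1 m]

/-- The value of a register in unary. -/
theorem emitAt_reg {d : ℕ} {i : ℕ} (hi : i < d) (hD : d ≤ D) (a : Δ) :
    EmitAt Γ D d (fun ρ => List.replicate (ρ i) a) := by
  -- Draining takes three steps per unit and restoring takes two, with one closing test each, hence
  -- `5 * X + 2`.
  refine ⟨fun τ => seq (whilePop (.val ⟨i, hi.trans_le hD⟩)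
    fun _ => seq (emitSym τ a) (push .scr ()))
    (whilePop .scr fun _ => push (.val ⟨i, hi.trans_le hD⟩) ()), 5 * Polynomial.X + 2,
    fun τ s M hτ hs hM => ⟨?_, (3 * s.val i + 1) + (2 * s.val i + 1), ?_, ?_⟩⟩
  · have := hM i
    simp
    omega
  · have := hM i
    simp
    omega
  · have h₁ := run_drain_val s ⟨i, hi.trans_le hD⟩ τ a
    have h₂ := run_restore_val (D := D) (({s with
      val := Function.update s.val i 0, scr := s.scr + s.val i} : Mem Γ Δ).emit τ
        (List.replicate (s.val i) a)) ⟨i, hi.trans_le hD⟩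
    convert Run.seq h₁ h₂ using 1
    · simp [hs.1]
    · congr 1
      have := hs.1
      cases τ <;> ext1 <;> simp [Mem.emit, this]

/-- The loop counter `cnt d` holds the `j` rounds still to do, while `val d` holds the current index
`m`. Their sum is invariant, so all register values stay below `M`. A round costs the body plus one
pop and one push, hence `T + 2`. -/
theorem run_loop {d : ℕ} (hd : d < D) {g : (ℕ → ℕ) → List Δ} {M T : ℕ} {τ : Option (Fin D)}
    (hτ : ∀ i, τ = some i → (i : ℕ) < d) {p : StackProg (RegAlphabet Γ Δ (D := D))}
    (hp : ∀ s : Mem Γ Δ, s.Clean (d + 1) → (∀ i, s.val i ≤ M) →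
      ∃ t ≤ T, Run p s.stk t (s.emit τ (g s.val)).stk) (j m : ℕ) (s : Mem Γ Δ)
    (hs : s.Clean (d + 1)) (hM : ∀ i, s.val i ≤ M) (hm : s.val d = m) (hj : s.cnt d = j)
    (hmj : m + j ≤ M) :
    ∃ t ≤ j * (T + 2) + 1,
      Run (whilePop (.cnt ⟨d, hd⟩) fun _ => seq p (push (.val ⟨d, hd⟩) ())) s.stk t
        (({ s with
            val := Function.update s.val d (m + j)
            cnt := Function.update s.cnt d 0 } : Mem Γ Δ).emit τ
          ((List.range' m j).flatMap fun i => g (Function.update s.val d i))).stk := by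
  have hτ' : ∀ i, τ = some i → (i : ℕ) ≠ d := fun i hi => (hτ i hi).ne
  induction j generalizing s m with
  | zero =>
    refine ⟨1, by simp, ?_⟩
    have e : ({ s with
        val := Function.update s.val d (m + 0)
        cnt := Function.update s.cnt d 0 } : Mem Γ Δ) = s := by
      ext1 <;> simp [← hm, ← hj]
    rw [e]
    simp only [List.range'_zero, List.flatMap_nil, Mem.emit_nil]
    exact Run.whilePop_nil _ (by simp [Mem.stk, hj])
  | succ j ih =>
    set s₁ : Mem Γ Δ := {s with cnt := Function.update s.cnt d j} with hs₁
    have hc₁ : s₁.Clean (d + 1) := by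
      refine ⟨hs.1, fun i hi => ⟨(hs.2 i hi).1, ?_⟩⟩
      rw [hs₁]
      simpa [Function.update_of_ne (show i ≠ d by omega)] using (hs.2 i hi).2
    obtain ⟨t₁, ht₁, hr₁⟩ := hp s₁ hc₁ hM
    set s₂ : Mem Γ Δ := {s₁.emit τ (g s.val) with
      val := Function.update s.val d (m + 1)} with hs₂
    have hr₂ := run_push_val (s₁.emit τ (g s.val)) ⟨d, hd⟩
    have hval : s₂.val = Function.update s.val d (m + 1) := rfl
    have hcnt : ∀ i, d ≤ i → s₂.cnt i = s₁.cnt i := fun i hi => by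
      rw [hs₂]
      exact Mem.emit_cnt _ _ _ fun k hk => ((hτ k hk).trans_le hi).ne
    have hc₂ : s₂.Clean (d + 1) := by
      refine ⟨by simpa [hs₂] using hc₁.1, fun i hi => ⟨?_, ?_⟩⟩
      · rw [hval, Function.update_of_ne (by omega)]
        exact (hs.2 i hi).1
      · rw [hcnt i (by omega)]
        exact (hc₁.2 i hi).2
    obtain ⟨t₃, ht₃, hr₃⟩ := ih (m + 1) s₂ hc₂ (fun i => by
        rw [hval]
        rcases eq_or_ne i d with rfl | h
        · simp; omega
        · simpa [h] using hM i) (by simp [hval]) (by rw [hcnt d le_rfl]; simp [hs₁]) (by omega)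
    refine ⟨1 + (t₁ + 1) + t₃, ?_, ?_⟩
    · rw [add_mul]
      omega
    · have e₂ : ({ s₁.emit τ (g s₁.val) with
          val := Function.update (s₁.emit τ (g s₁.val)).val d
            ((s₁.emit τ (g s₁.val)).val d + 1) } : Mem Γ Δ) = s₂ := by
        simp [hs₂, hs₁, hm]
      have hr₂' : Run (push (A := RegAlphabet Γ Δ (D := D)) (.val ⟨d, hd⟩) ())
          (s₁.emit τ (g s₁.val)).stk 1 s₂.stk := by
        rw [← e₂]
        exact hr₂
      convert run_whilePop_cnt_cons (i := ⟨d, hd⟩) hj (Run.seq hr₁ hr₂') hr₃ using 1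
      rw [List.range'_succ, List.flatMap_cons, Mem.emit_append]
      congr 1
      rw [show Function.update s.val d m = s.val by rw [← hm, Function.update_eq_self]]
      rw [hval]
      simp only [Function.update_idem]
      congr 1
      rw [hs₂, hs₁]
      cases τ with
      | none => ext1 <;> simp [Mem.emit, add_assoc, add_comm 1 j]
      | some i =>
        have := hτ' i rfl
        ext1 <;> simp [Mem.emit, Function.update_of_ne this, add_assoc, add_comm 1 j,
          Function.update_comm this]

/-- Bounded iteration. -/
theorem EmitAt.flatMap_range {d : ℕ} (hd : d < D) {e g : (ℕ → ℕ) → List Δ}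
    (he : EmitAt Γ D (d + 1) e) (hg : EmitAt Γ D (d + 1) g) :
    EmitAt Γ D d (fun ρ => (List.range (e ρ).length).flatMap fun m =>
      g (Function.update ρ d m)) := by
  obtain ⟨p, c, hp⟩ := he
  obtain ⟨p', c', hp'⟩ := hg
  -- The program for `e` runs with the counter `cnt d` as its target, so only the length of its word
  -- is recorded. The loop then consumes that counter, and the last loop clears the index register.
  refine ⟨fun τ => seq (p (some ⟨d, hd⟩)) (seq
    (whilePop (.cnt ⟨d, hd⟩) fun _ => seq (p' τ) (push (.val ⟨d, hd⟩) ()))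
    (whilePop (.val ⟨d, hd⟩) fun _ => skip)),
    c + (c * (c'.comp (Polynomial.X + c) + 2) + 1) + (2 * c + 1), fun τ s M hτ hs hM => ?_⟩
  have hs' : s.Clean (d + 1) := ⟨hs.1, fun i hi => hs.2 i (by omega)⟩
  obtain ⟨hl, t, ht, hr⟩ := hp (some ⟨d, hd⟩) s M (by rintro i ⟨⟩; simp) hs' hM
  set n := (e s.val).length with hn
  -- The loop index can exceed `M`, but it is at most the length of `e s.val`, so `M'` bounds all
  -- registers during the loop. This explains the composition with `X + c`.
  set M' := M + c.eval M with hM'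
  have hval : s.val d = 0 := (hs.2 d le_rfl).1
  have hcnt : s.cnt d = 0 := (hs.2 d le_rfl).2
  set s₁ := s.emit (some (⟨d, hd⟩ : Fin D)) (e s.val) with hs₁
  have hc₁ : s₁.Clean (d + 1) := by
    refine ⟨hs.1, fun i hi => ⟨(hs'.2 i hi).1, ?_⟩⟩
    rw [hs₁, Mem.emit_cnt _ _ _ (by rintro j ⟨⟩; simp; omega)]
    exact (hs'.2 i hi).2
  obtain ⟨t', ht', hr'⟩ := run_loop (M := M') (T := c'.eval M') hd hτ (p := p' τ) (g := g)
    (fun s' hc' hb' => (hp' τ s' M' (fun i hi => (hτ i hi).trans (Nat.lt_succ_self d)) hc' hb').2)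
    n 0 s₁ hc₁ (fun i => (hM i).trans (Nat.le_add_right _ _)) hval
    (by simp [hs₁, Mem.emit, hcnt, hn]) (by omega)
  have hr'' := run_clear_val (D := D) (({ s₁ with
            val := Function.update s₁.val d (0 + n)
            cnt := Function.update s₁.cnt d 0 } : Mem Γ Δ).emit τ
          ((List.range' 0 n).flatMap fun i => g (Function.update s₁.val d i))) ⟨d, hd⟩
  have hn' : (({ s₁ with
            val := Function.update s₁.val d (0 + n)
            cnt := Function.update s₁.cnt d 0 } : Mem Γ Δ).emit τ
          ((List.range' 0 n).flatMap fun i => g (Function.update s₁.val d i))).val d = n := by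
    simp
  rw [show ((⟨d, hd⟩ : Fin D) : ℕ) = d from rfl, hn'] at hr''
  have hmul : n * (c'.eval M' + 2) ≤ c.eval M * (c'.eval M' + 2) := Nat.mul_le_mul_right _ hl
  refine ⟨?_, t + (t' + (2 * n + 1)), ?_, ?_⟩
  · have h₁ : ((List.range n).flatMap fun m => g (Function.update s.val d m)).length ≤
        n * c'.eval M' := by
      rw [List.length_flatMap]
      refine (List.sum_le_card_nsmul _ (c'.eval M') ?_).trans (by simp)
      intro x hx
      obtain ⟨m, hm, rfl⟩ := List.mem_map.1 hx
      rw [List.mem_range] at hm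
      refine (hp' none {s with val := Function.update s.val d m} M' (by simp) ⟨hs.1, fun i hi =>
        ⟨?_, (hs'.2 i hi).2⟩⟩ ?_).1
      · simpa [Function.update_of_ne (show i ≠ d by omega)] using (hs'.2 i hi).1
      · intro i
        rcases eq_or_ne i d with rfl | h
        · simp; omega
        · simpa [h] using (hM i).trans (Nat.le_add_right _ _)
    simp only [Polynomial.eval_add, Polynomial.eval_mul, Polynomial.eval_comp, Polynomial.eval_X,
      Polynomial.eval_one, Polynomial.eval_ofNat, ← hM']
    have h₂ : n * c'.eval M' ≤ n * (c'.eval M' + 2) := Nat.mul_le_mul_left _ (by omega)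
    refine h₁.trans ?_
    omega
  · simp only [Polynomial.eval_add, Polynomial.eval_mul, Polynomial.eval_comp, Polynomial.eval_X,
      Polynomial.eval_one, Polynomial.eval_ofNat, ← hM']
    omega
  · refine Run.seq hr (Run.seq hr' ?_)
    convert hr'' using 2
    have hrange : ((List.range' 0 n).flatMap fun i => g (Function.update s₁.val d i)) =
        (List.range n).flatMap fun m => g (Function.update s.val d m) := by
      rw [← List.range_eq_range']
      rfl
    have hu : Function.update s.val d 0 = s.val := by rw [← hval, Function.update_eq_self]
    have hu' : Function.update s.cnt d 0 = s.cnt := by rw [← hcnt, Function.update_eq_self]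
    rw [hrange, hs₁]
    simp only [← hn]
    cases τ with
    | none => ext1 <;> simp [Mem.emit, hu, hu']
    | some i =>
      have := (hτ i rfl).ne
      ext1 <;> simp [Mem.emit, hu, hu', Function.update_of_ne this]

/-! ### Hiding the number of registers -/

/-- The word `g ρ` can be written in polynomial time from the values `ρ` of the registers below
`d`. -/
def Emit (Γ : Type) (d : ℕ) (g : (ℕ → ℕ) → List Δ) : Prop :=
  ∃ h, ∀ D, d + h ≤ D → EmitAt Γ D d g

/-- The number `e ρ` depends only on the registers below `d`, and can be written in unary in
polynomial time. -/
def Num (Γ Δ : Type) (d : ℕ) (e : (ℕ → ℕ) → ℕ) : Prop :=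
  (∀ ρ ρ' : ℕ → ℕ, (∀ i < d, ρ i = ρ' i) → e ρ = e ρ') ∧
  ∃ h, ∀ d' D, d ≤ d' → d' + h ≤ D → ∀ a : Δ, EmitAt Γ D d' (fun ρ => List.replicate (e ρ) a)

theorem num_const (d n : ℕ) : Num Γ Δ d (fun _ => n) :=
  ⟨fun _ _ _ => rfl, 0, fun _ _ _ _ a => emitAt_const _ (List.replicate n a)⟩

theorem num_reg {d i : ℕ} (hi : i < d) : Num Γ Δ d (fun ρ => ρ i) :=
  ⟨fun _ _ h => h i hi, 0, fun _ _ h h' a => emitAt_reg (hi.trans_le h) h' a⟩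

theorem Num.add {d : ℕ} {e e' : (ℕ → ℕ) → ℕ} (h : Num Γ Δ d e) (h' : Num Γ Δ d e') :
    Num Γ Δ d (fun ρ => e ρ + e' ρ) := by
  obtain ⟨hc, k, h⟩ := h
  obtain ⟨hc', k', h'⟩ := h'
  refine ⟨fun ρ ρ' hρ => by simp only [hc ρ ρ' hρ, hc' ρ ρ' hρ], max k k',
    fun d' D hd hD a => ?_⟩
  simp only [List.replicate_add]
  exact (h d' D hd (by omega) a).append (h' d' D hd (by omega) a)

/-- A product is repeated addition: `e'` symbols are written `e` times. The locality clause of `Num`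
ensures that the index in register `d'` does not affect `e'`. -/
theorem Num.mul {d : ℕ} {e e' : (ℕ → ℕ) → ℕ} (h : Num Γ Δ d e) (h' : Num Γ Δ d e') :
    Num Γ Δ d (fun ρ => e ρ * e' ρ) := by
  obtain ⟨hc, k, h⟩ := h
  obtain ⟨hc', k', h'⟩ := h'
  refine ⟨fun ρ ρ' hρ => by simp only [hc ρ ρ' hρ, hc' ρ ρ' hρ], max k k' + 1,
    fun d' D hd hD a => ?_⟩
  have := EmitAt.flatMap_range (d := d') (by omega) (h (d' + 1) D (by omega) (by omega) a)
    (h' (d' + 1) D (by omega) (by omega) a)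
  convert this using 2 with ρ
  have h₁ : ∀ m, e' (Function.update ρ d' m) = e' ρ := fun m =>
    hc' _ _ fun i hi => Function.update_of_ne (by omega) _ _
  simp only [h₁, List.length_replicate]
  have h₂ : ∀ n, List.replicate (n * e' ρ) a =
      (List.range n).flatMap fun _ => List.replicate (e' ρ) a := by
    intro n
    induction n with
    | zero => simp
    | succ n ih => rw [List.range_succ, List.flatMap_append, ← ih]; rw [add_mul, one_mul, List.replicate_add]; simp
  exact h₂ _

theorem Num.polynomial {d : ℕ} {e : (ℕ → ℕ) → ℕ} (h : Num Γ Δ d e) (c : Polynomial ℕ) :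
    Num Γ Δ d (fun ρ => c.eval (e ρ)) := by
  induction c using Polynomial.induction_on with
  | C a => simpa using num_const d a
  | add p q hp hq => simpa using hp.add hq
  | monomial n a ih =>
    have : ∀ ρ : ℕ → ℕ, (Polynomial.C a * Polynomial.X ^ (n + 1)).eval (e ρ) =
        (Polynomial.C a * Polynomial.X ^ n).eval (e ρ) * e ρ := fun ρ => by
      simp [pow_succ, mul_assoc]
    simp only [this]
    exact ih.mul h

theorem Num.emit {d : ℕ} {e : (ℕ → ℕ) → ℕ} (h : Num Γ Δ d e) (a : Δ) :
    Emit Γ d (fun ρ => List.replicate (e ρ) a) := by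
  obtain ⟨_, k, h⟩ := h
  exact ⟨k, fun D hD => h d D le_rfl hD a⟩

theorem emit_const (d : ℕ) (L : List Δ) : Emit Γ d (fun _ => L) :=
  ⟨0, fun _ _ => emitAt_const d L⟩

theorem Emit.append {d : ℕ} {g g' : (ℕ → ℕ) → List Δ} (h : Emit Γ d g) (h' : Emit Γ d g') :
    Emit Γ d (fun ρ => g ρ ++ g' ρ) := by
  obtain ⟨k, h⟩ := h
  obtain ⟨k', h'⟩ := h'
  exact ⟨max k k', fun D hD => (h D (by omega)).append (h' D (by omega))⟩

theorem Emit.flatMap_range [Inhabited Δ] {d : ℕ} {e : (ℕ → ℕ) → ℕ} {g : (ℕ → ℕ) → List Δ}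
    (he : Num Γ Δ d e) (hg : Emit Γ (d + 1) g) :
    Emit Γ d (fun ρ => (List.range (e ρ)).flatMap fun m => g (Function.update ρ d m)) := by
  obtain ⟨_, k, he⟩ := he
  obtain ⟨k', hg⟩ := hg
  refine ⟨max k k' + 1, fun D hD => ?_⟩
  -- The bound is written into a counter, where only the length matters, so any symbol serves.
  have := EmitAt.flatMap_range (d := d) (by omega) (he (d + 1) D (by omega) (by omega) default)
    (hg D (by omega))
  simpa using this

theorem emit_flatMap {ι : Type} {d : ℕ} (l : List ι) {g : ι → (ℕ → ℕ) → List Δ}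
    (h : ∀ a ∈ l, Emit Γ d (g a)) : Emit Γ d (fun ρ => l.flatMap fun a => g a ρ) := by
  induction l with
  | nil => exact emit_const d []
  | cons a l ih =>
    simp only [List.mem_cons, forall_eq_or_imp] at h
    exact h.1.append (ih h.2)

end StackProg

/-! ### Reading the input and delivering the output -/

namespace StackProg

variable {Γ Δ : Type} {D : ℕ}

/-- The word under construction has its last symbol on top; transferring it to the output stack puts
the first symbol on top. -/
theorem run_reverse_word (s : Mem Γ Δ) :
    Run (whilePop (A := RegAlphabet Γ Δ (D := D)) .word fun a => push .out a) s.stk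
      (2 * s.word.length + 1) ({ s with word := [], out := s.word.reverse ++ s.out } :
        Mem Γ Δ).stk := by
  generalize hw : s.word = w
  induction w generalizing s with
  | nil =>
    have e : ({ s with word := [], out := [].reverse ++ s.out } : Mem Γ Δ) = s := by
      ext1 <;> simp [hw]
    rw [e]
    exact Run.whilePop_nil _ hw
  | cons a w ih =>
    have h₁ := run_push_out (D := D) { s with word := w } a
    have h₂ := ih { s with word := w, out := a :: s.out } rfl
    rw [← s.update_word w] at h₁
    convert Run.whilePop_cons (A := RegAlphabet Γ Δ (D := D)) (k := .word) hw h₁ h₂ using 1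
    · simp
      omega
    · simp

/-- The values of the registers when only the first one is in use. -/
abbrev oneReg (n : ℕ) : ℕ → ℕ := Function.update (fun _ => 0) 0 n

/-- Register `0` counts the symbols already read. During the loop it is the position of the current
symbol, and afterwards it is the input length, which the rest of the word needs. -/
theorem run_read_input (hD : 0 < D) {g : Γ → (ℕ → ℕ) → List Δ} {c : Polynomial ℕ}
    {p : Γ → StackProg (RegAlphabet Γ Δ (D := D))}
    (hp : ∀ a (s : Mem Γ Δ) (M : ℕ), s.Clean 1 → (∀ i, s.val i ≤ M) →
      (g a s.val).length ≤ c.eval M ∧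
        ∃ t ≤ c.eval M, Run (p a) s.stk t (s.emit (none : Option (Fin D)) (g a s.val)).stk)
    (N : ℕ) (x : List Γ) (m : ℕ) (w : List Δ) (hN : m + x.length ≤ N) :
    ((x.zipIdx m).flatMap fun a => g a.1 (oneReg a.2)).length ≤ x.length * c.eval N ∧
    ∃ t ≤ x.length * (c.eval N + 2) + 1,
      Run (whilePop (A := RegAlphabet Γ Δ (D := D)) .inp fun a => seq (p a) (push (.val ⟨0, hD⟩) ()))
        ({ inp := x, word := w, val := oneReg m } : Mem Γ Δ).stk t
        ({ word := ((x.zipIdx m).flatMap fun a => g a.1 (oneReg a.2)).reverse ++ w,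
           val := oneReg (m + x.length) } : Mem Γ Δ).stk := by
  induction x generalizing m w with
  | nil => exact ⟨by simp, 1, by simp, by simpa using Run.whilePop_nil _ rfl⟩
  | cons a x ih =>
    simp only [List.length_cons] at hN
    obtain ⟨hl, t₁, ht₁, hr₁⟩ := hp a { inp := x, word := w, val := oneReg m } N
      ⟨rfl, fun i hi => ⟨by simp [oneReg, show i ≠ 0 by omega], rfl⟩⟩ (fun i => by
        rcases eq_or_ne i 0 with rfl | h
        · simp; omega
        · simp [h])
    have hr₂ := run_push_val (D := D) ({
      inp := x, word := (g a (oneReg m)).reverse ++ w, val := oneReg m } : Mem Γ Δ) ⟨0, hD⟩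
    simp only [Function.update_idem, Function.update_self] at hr₂
    obtain ⟨hl₃, t₃, ht₃, hr₃⟩ := ih (m + 1) ((g a (oneReg m)).reverse ++ w) (by omega)
    refine ⟨?_, 1 + (t₁ + 1) + t₃, ?_, ?_⟩
    · simp only [List.zipIdx_cons, List.flatMap_cons, List.length_append, List.length_cons, add_mul]
      simp only at hl
      omega
    · simp only [List.length_cons, add_mul (x.length)]
      omega
    · have hu := Mem.update_inp (D := D) ({ inp := a :: x, word := w, val := oneReg m } : Mem Γ Δ) x
      convert Run.whilePop_cons (A := RegAlphabet Γ Δ (D := D)) (k := .inp)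
        (S := ({ inp := a :: x, word := w, val := oneReg m } : Mem Γ Δ).stk) rfl
        (hu ▸ Run.seq hr₁ hr₂) hr₃ using 1
      simp [add_assoc, add_comm 1 x.length]

/-- A function is computable in polynomial time if its value consists of a constant, a word for
every symbol of the input that depends on the symbol and its position, and a word that depends on
the length of the input. -/
theorem polyTime_of_emit [Fintype Γ] [Fintype Δ] (L : List Δ) {g : Γ → (ℕ → ℕ) → List Δ}
    {g' : (ℕ → ℕ) → List Δ} (hg : ∀ a, Emit Γ 1 (g a)) (hg' : Emit Γ 1 g') :
    Nonempty (Turing.TM2ComputableInPolyTime (id : List Γ → List Γ) (id : List Δ → List Δ)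
      fun x => L ++ (x.zipIdx.flatMap fun a => g a.1 (oneReg a.2)) ++ g' (oneReg x.length)) := by
  choose h hg using hg
  obtain ⟨h', hg'⟩ := hg'
  -- One machine must serve every input symbol, so the number of registers is taken large enough for
  -- all of them at once.
  set D := 1 + (∑ a, h a) + h' with hD
  have hh : ∀ a, h a ≤ ∑ a, h a := fun a => Finset.single_le_sum (fun _ _ => Nat.zero_le _)
    (Finset.mem_univ a)
  have hD0 : 0 < D := by omega
  have hg₁ : ∀ a, EmitAt Γ D 1 (g a) := fun a => hg a D (by have := hh a; omega)
  choose p c hp using hg₁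
  obtain ⟨p', c', hp'⟩ := hg' D (by omega)
  obtain ⟨p₀, c₀, hp₀⟩ := emitAt_const (Γ := Γ) (D := D) 1 L
  set C : Polynomial ℕ := ∑ a, c a with hC
  have hcC : ∀ a M, (c a).eval M ≤ C.eval M := fun a M => by
    rw [hC, Polynomial.eval_finsetSum]
    exact Finset.single_le_sum (f := fun a => (c a).eval M) (fun _ _ => Nat.zero_le _)
      (Finset.mem_univ a)
  -- Register `0` is cleared before the reversal because at the end every stack but the output must
  -- be empty.
  refine polyTime_of_run (A := RegAlphabet Γ Δ (D := D))
    (seq (p₀ none) <| seq (whilePop .inp fun a => seq (p a none) (push (.val ⟨0, hD0⟩) ())) <|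
      seq (p' none) <| seq (whilePop (.val ⟨0, hD0⟩) fun _ => skip)
        (whilePop .word fun a => push .out a)) .inp .out _
    (c₀ + (Polynomial.X * (C + 2) + 1) + c' + (2 * Polynomial.X + 1) +
      (2 * (c₀ + Polynomial.X * C + c') + 1)) fun x => ?_
  set N := List.length x with hN
  obtain ⟨hl₀, t₀, ht₀, hr₀⟩ := hp₀ none { inp := x } N (by simp) ⟨rfl, fun i _ => ⟨rfl, rfl⟩⟩
    (fun i => Nat.zero_le _)
  obtain ⟨hl₁, t₁, ht₁, hr₁⟩ := run_read_input (c := C) (p := fun a => p a none) (g := g) hD0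
    (fun a s M hs hM => by
      obtain ⟨hl, t, ht, hr⟩ := hp a none s M (by simp) hs hM
      exact ⟨hl.trans (hcC a M), t, ht.trans (hcC a M), hr⟩) N x 0 (L.reverse ++ [])
    (by simp [hN])
  set W := x.zipIdx.flatMap fun a => g a.1 (oneReg a.2) with hW
  rw [zero_add] at hr₁
  obtain ⟨hl₂, t₂, ht₂, hr₂⟩ := hp' none
    { word := W.reverse ++ (L.reverse ++ []), val := oneReg N } N (by simp)
      ⟨rfl, fun i hi => ⟨by simp [oneReg, show i ≠ 0 by omega], rfl⟩⟩ (fun i => by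
        rcases eq_or_ne i 0 with rfl | h
        · simp
        · simp [h])
  have hr₃ := run_clear_val (D := D) ({
    word := (g' (oneReg N)).reverse ++ (W.reverse ++ (L.reverse ++ []))
    val := oneReg N } : Mem Γ Δ) ⟨0, hD0⟩
  have hr₄ := run_reverse_word (D := D) ({
    word := (g' (oneReg N)).reverse ++ (W.reverse ++ (L.reverse ++ []))
    val := Function.update (oneReg N) 0 0 } : Mem Γ Δ)
  have e₀ : (({ inp := x } : Mem Γ Δ).emit (none : Option (Fin D)) L).stk (D := D) =
      ({ inp := x, word := L.reverse ++ [], val := oneReg 0 } : Mem Γ Δ).stk := by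
    congr 1
    ext1 <;> simp [Mem.emit]
  have hrun := Run.seq hr₀ (Run.seq (e₀ ▸ hr₁) (Run.seq hr₂ (Run.seq hr₃ hr₄)))
  have e_inp : Function.update (β := fun k : Reg D => List (RegAlphabet Γ Δ k)) (fun _ => [])
      .inp x = ({ inp := x } : Mem Γ Δ).stk (D := D) := by
    rw [← Mem.update_inp (D := D) ({} : Mem Γ Δ) x]
    congr 1
    funext k
    cases k <;> rfl
  have e_out : Function.update (β := fun k : Reg D => List (RegAlphabet Γ Δ k)) (fun _ => []) .out
      (L ++ W ++ g' (oneReg N)) =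
      ({ out := ((g' (oneReg N)).reverse ++ (W.reverse ++ (L.reverse ++ []))).reverse ++ []
         val := Function.update (oneReg N) 0 0 } : Mem Γ Δ).stk (D := D) := by
    have e : ({ out := ((g' (oneReg N)).reverse ++ (W.reverse ++ (L.reverse ++ []))).reverse ++ []
                val := Function.update (oneReg N) 0 0 } : Mem Γ Δ) =
        { out := L ++ W ++ g' (oneReg N) } := by
      ext1 <;> simp
    rw [e, ← Mem.update_out (D := D) ({} : Mem Γ Δ) (L ++ W ++ g' (oneReg N))]
    congr 1
    funext k
    cases k <;> rfl
  rw [e_inp, e_out]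
  refine ⟨_, ?_, hrun⟩
  · simp only [Polynomial.eval_add, Polynomial.eval_mul, Polynomial.eval_X,
      Polynomial.eval_one, Polynomial.eval_ofNat, Function.update_self, List.length_append,
      List.length_reverse, List.length_nil]
    simp only at hl₂ hl₀
    have hN' : List.length (α := Γ) x = N := rfl
    rw [hN'] at hl₁ ht₁
    omega

end StackProg

/-! ## Tableaux of stack machines -/

namespace StackTableau

open Turing TM2

variable {K : Type} {A : K → Type} {Λ σ : Type}

section

variable [DecidableEq K]

/-- The finite control: a statement still to be executed and the internal state. -/
abbrev Control (A : K → Type) (Λ σ : Type) : Type := Stmt A Λ σ × σ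

/-- The next control, when one elementary instruction is executed; it depends on the symbols on top
of the stacks. A halted machine stays as it is. -/
def nextControl (M : Λ → Stmt A Λ σ) (top : ∀ k, Option (A k)) : Control A Λ σ → Control A Λ σ
  | (.push _ _ q, v) => (q, v)
  | (.peek k f q, v) => (q, f v (top k))
  | (.pop k f q, v) => (q, f v (top k))
  | (.load a q, v) => (q, a v)
  | (.branch p q₁ q₂, v) => (cond (p v) q₁ q₂, v)
  | (.goto l, v) => (M (l v), v)
  | (.halt, v) => (.halt, v)

/-- The next stacks, when one elementary instruction is executed. -/
def nextStacks : Control A Λ σ → (∀ k, List (A k)) → ∀ k, List (A k)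
  | (.push k f _, v), S => Function.update S k (f v :: S k)
  | (.pop k _ _, _), S => Function.update S k (S k).tail
  | _, S => S

/-- The execution of one elementary instruction. -/
def micro (M : Λ → Stmt A Λ σ) (c : Control A Λ σ × ∀ k, List (A k)) :
    Control A Λ σ × ∀ k, List (A k) :=
  (nextControl M (fun k => (c.2 k).head?) c.1, nextStacks c.1 c.2)

/-- A configuration of the machine, for the execution by elementary instructions. -/
def ofCfg (M : Λ → Stmt A Λ σ) (c : Cfg A Λ σ) : Control A Λ σ × ∀ k, List (A k) :=
  ((c.l.elim .halt M, c.var), c.stk)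

/-- An upper bound for the number of elementary instructions in an execution of a statement. -/
def depth : Stmt A Λ σ → ℕ
  | .push _ _ q => depth q + 1
  | .peek _ _ q => depth q + 1
  | .pop _ _ q => depth q + 1
  | .load _ q => depth q + 1
  | .branch _ q₁ q₂ => max (depth q₁) (depth q₂) + 1
  | .goto _ => 1
  | .halt => 0

/-- A single machine step runs a statement up to its `goto` or `halt`. Each elementary instruction
descends to a substatement, so the depth of the statement bounds their number. -/
theorem exists_micro_stepAux (M : Λ → Stmt A Λ σ) (q : Stmt A Λ σ) (v : σ)
    (S : ∀ k, List (A k)) :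
    ∃ j ≤ depth q, (micro M)^[j] ((q, v), S) = ofCfg M (stepAux q v S) := by
  induction q generalizing v S with
  | push k f q ih =>
    obtain ⟨j, hj, h⟩ := ih v (Function.update S k (f v :: S k))
    exact ⟨j + 1, Nat.succ_le_succ hj, h⟩
  | peek k f q ih =>
    obtain ⟨j, hj, h⟩ := ih (f v (S k).head?) S
    exact ⟨j + 1, Nat.succ_le_succ hj, h⟩
  | pop k f q ih =>
    obtain ⟨j, hj, h⟩ := ih (f v (S k).head?) (Function.update S k (S k).tail)
    exact ⟨j + 1, Nat.succ_le_succ hj, h⟩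
  | load a q ih =>
    obtain ⟨j, hj, h⟩ := ih (a v) S
    exact ⟨j + 1, Nat.succ_le_succ hj, h⟩
  | branch p q₁ q₂ ih₁ ih₂ =>
    cases hp : p v with
    | true =>
      obtain ⟨j, hj, h⟩ := ih₁ v S
      refine ⟨j + 1, Nat.succ_le_succ (hj.trans (le_max_left _ _)), ?_⟩
      simpa [micro, nextControl, nextStacks, stepAux, hp] using h
    | false =>
      obtain ⟨j, hj, h⟩ := ih₂ v S
      refine ⟨j + 1, Nat.succ_le_succ (hj.trans (le_max_right _ _)), ?_⟩
      simpa [micro, nextControl, nextStacks, stepAux, hp] using h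
  | goto l => exact ⟨1, le_rfl, rfl⟩
  | halt => exact ⟨0, le_rfl, rfl⟩

theorem exists_micro_iterate (M : Λ → Stmt A Λ σ) {d : ℕ} (hd : ∀ l, depth (M l) ≤ d) (n : ℕ)
    (c c' : Cfg A Λ σ) (h : (flip bind (step M))^[n] (some c) = some c') :
    ∃ j ≤ n * d, (micro M)^[j] (ofCfg M c) = ofCfg M c' := by
  induction n generalizing c with
  | zero =>
    obtain rfl : c = c' := by simpa using h
    exact ⟨0, Nat.zero_le _, rfl⟩
  | succ n ih =>
    rw [Function.iterate_succ_apply] at h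
    obtain ⟨_ | l, v, S⟩ := c
    -- A halted configuration has no successor, so it cannot be followed by further successful
    -- steps.
    · exfalso
      have h₁ : flip bind (step M) (some ⟨none, v, S⟩) = none := rfl
      have h₂ : ∀ n, (flip bind (step M))^[n] none = none := fun n => by
        induction n with
        | zero => rfl
        | succ n ih => rw [Function.iterate_succ_apply]; exact ih
      rw [h₁, h₂] at h
      cases h
    · obtain ⟨j, hj, hj'⟩ := exists_micro_stepAux M (M l) v S
      obtain ⟨i, hi, hi'⟩ := ih (stepAux (M l) v S) h
      refine ⟨i + j, ?_, ?_⟩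
      · have := hd l
        rw [add_mul]
        omega
      · rw [Function.iterate_add_apply]
        exact (congrArg _ hj').trans hi'

theorem iterate_micro_halt (M : Λ → Stmt A Λ σ) (v : σ) (S : ∀ k, List (A k)) (n : ℕ) :
    (micro M)^[n] ((.halt, v), S) = ((.halt, v), S) :=
  Function.iterate_fixed rfl n

/-! ### Cells of a tableau -/

/-- The contents of a cell of a tableau: the control, or the symbols of all stacks at some depth. -/
abbrev Cell (A : K → Type) (Λ σ : Type) : Type := Control A Λ σ ⊕ ∀ k, Option (A k)

/-- A row of the tableau. -/
def cell (c : Control A Λ σ × ∀ k, List (A k)) : ℕ → Cell A Λ σ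
  | 0 => .inl c.1
  | p + 1 => .inr fun k => (c.2 k)[p]?

/-- The symbols of the stacks in a cell. -/
def Cell.column : Cell A Λ σ → ∀ k, Option (A k)
  | .inl _ => fun _ => none
  | .inr s => s

/-- The symbols of the stacks at some depth after an elementary instruction, from the control,
the cell to the left, and the symbols at this depth and the depth below. -/
def nextColumn : Control A Λ σ → Cell A Λ σ → (∀ k, Option (A k)) → (∀ k, Option (A k)) →
    ∀ k, Option (A k)
  | (.push k f _, v), b, s, _ =>
      Function.update s k (match b with
        | .inl _ => some (f v)
        | .inr s' => s' k)
  | (.pop k _ _, _), _, s, s' => Function.update s k (s' k)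
  | _, _, s, _ => s

/-- The local rule: a cell of the next row from the first cell, the left neighbour, the cell itself
and the right neighbour in the present row. -/
def rule (M : Λ → Stmt A Λ σ) : Cell A Λ σ → Cell A Λ σ → Cell A Λ σ → Cell A Λ σ → Cell A Λ σ
  | _, _, .inl q, d => .inl (nextControl M d.column q)
  | .inl q, b, .inr s, d => .inr (nextColumn q b s d.column)
  | .inr _, _, .inr s, _ => .inr s

/-- A push moves a column in from the left neighbour, a pop from the right neighbour, and the
control reads the tops from its right neighbour. The left neighbour is constrained only for `p > 0`,
and only the column of the right one matters; this leaves room for the ends of rows. -/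
theorem cell_micro (M : Λ → Stmt A Λ σ) (c : Control A Λ σ × ∀ k, List (A k)) (p : ℕ)
    (b d : Cell A Λ σ) (hb : ∀ p', p = p' + 1 → b = cell c p')
    (hd : d.column = (cell c (p + 1)).column) :
    cell (micro M c) p = rule M (cell c 0) b (cell c p) d := by
  obtain ⟨⟨q, v⟩, S⟩ := c
  cases p with
  | zero =>
    simp only [cell, rule, hd]
    simp only [micro, Cell.column, List.head?_eq_getElem?]
  | succ p =>
    obtain rfl := hb p rfl
    simp only [cell, rule, hd]
    simp only [Cell.column, micro]
    congr 1
    cases q with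
    | push k f q =>
      funext k'
      simp only [nextStacks, nextColumn]
      rcases eq_or_ne k' k with rfl | hk
      · cases p <;> simp
      · simp [hk]
    | pop k f q =>
      funext k'
      simp only [nextStacks, nextColumn]
      rcases eq_or_ne k' k with rfl | hk
      · simp
      · simp [hk]
    | _ => rfl

theorem length_micro_le (M : Λ → Stmt A Λ σ) (c : Control A Λ σ × ∀ k, List (A k)) (k : K) :
    ((micro M c).2 k).length ≤ (c.2 k).length + 1 := by
  obtain ⟨⟨q, v⟩, S⟩ := c
  cases q with
  | push k' f q =>
    simp only [micro, nextStacks]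
    rcases eq_or_ne k k' with rfl | hk <;> simp [*]
  | pop k' f q =>
    simp only [micro, nextStacks]
    rcases eq_or_ne k k' with rfl | hk
    · simp; omega
    · simp [hk]
  | _ => simp [micro, nextStacks]

theorem length_iterate_micro_le (M : Λ → Stmt A Λ σ) (c : Control A Λ σ × ∀ k, List (A k)) (k : K)
    (n : ℕ) : (((micro M)^[n] c).2 k).length ≤ (c.2 k).length + n := by
  induction n with
  | zero => rfl
  | succ n ih =>
    rw [Function.iterate_succ_apply']
    exact (length_micro_le M _ k).trans (by omega)

end

/-! ### Only finitely many cell contents occur -/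

/-- The statements that occur in a computation. -/
def statements (M : Λ → Stmt A Λ σ) : Set (Stmt A Λ σ) :=
  insert .halt (⋃ l, (stmts₁ (M l) : Set (Stmt A Λ σ)))

/-- Statements form an infinite syntactic type, but a run only meets `halt` and substatements of the
finitely many `M l`. -/
theorem finite_statements [Finite Λ] (M : Λ → Stmt A Λ σ) : (statements M).Finite :=
  (Set.finite_iUnion fun _ => Finset.finite_toSet _).insert _

theorem mem_statements_of_mem_stmts₁ {M : Λ → Stmt A Λ σ} {q q' : Stmt A Λ σ}
    (hq : q ∈ statements M) (h : q' ∈ stmts₁ q) : q' ∈ statements M := by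
  rcases hq with rfl | hq
  · rw [stmts₁, Finset.mem_singleton] at h
    exact Or.inl h
  · obtain ⟨l, hl⟩ := Set.mem_iUnion.1 hq
    exact Or.inr (Set.mem_iUnion.2 ⟨l, stmts₁_trans hl h⟩)

theorem nextControl_mem_statements {M : Λ → Stmt A Λ σ} {q : Stmt A Λ σ} (hq : q ∈ statements M)
    (top : ∀ k, Option (A k)) (v : σ) : (nextControl M top (q, v)).1 ∈ statements M := by
  classical
  cases q with
  | goto l => exact Or.inr (Set.mem_iUnion.2 ⟨l v, stmts₁_self⟩)
  | halt => exact hq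
  | branch p q₁ q₂ =>
    refine mem_statements_of_mem_stmts₁ hq ?_
    simp only [nextControl, stmts₁]
    cases p v <;> simp [stmts₁_self]
  | _ =>
    refine mem_statements_of_mem_stmts₁ hq ?_
    simp [nextControl, stmts₁, stmts₁_self]

/-- The symbol pushed by the next elementary instruction. -/
def pushed : Control A Λ σ → Option (Σ k, A k)
  | (.push k f _, v) => some ⟨k, f v⟩
  | _ => none

/-- The symbols that occur in a computation with input on the stack `k₀`. -/
def symbols (M : Λ → Stmt A Λ σ) (k₀ : K) : Set (Σ k, A k) :=
  Set.range (Sigma.mk k₀) ∪ {s | ∃ q ∈ statements M, ∃ v, pushed (q, v) = some s}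

/-- Only the input alphabet is assumed finite. Any other symbol must be pushed, and it is determined
by one of finitely many statements and internal states. -/
theorem finite_symbols [Finite Λ] [Finite σ] (M : Λ → Stmt A Λ σ) (k₀ : K) [Finite (A k₀)] :
    (symbols M k₀).Finite := by
  refine (Set.finite_range _).union ?_
  refine Set.Finite.subset (s := some ⁻¹' (pushed '' (statements M ×ˢ (Set.univ : Set σ)))) ?_ ?_
  · exact (((finite_statements M).prod Set.finite_univ).image _).preimage
      (Option.some_injective _).injOn
  · rintro s ⟨q, hq, v, h⟩
    exact ⟨(q, v), ⟨hq, trivial⟩, h⟩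

/-- The cell contents that occur in a computation. -/
def cells (M : Λ → Stmt A Λ σ) (k₀ : K) : Set (Cell A Λ σ) :=
  Sum.inl '' (statements M ×ˢ Set.univ) ∪
    Sum.inr '' {s | ∀ k, s k ∈ {o : Option (A k) | ∀ a, o = some a → ⟨k, a⟩ ∈ symbols M k₀}}

theorem finite_cells [Finite K] [Finite Λ] [Finite σ] (M : Λ → Stmt A Λ σ) (k₀ : K)
    [Finite (A k₀)] : (cells M k₀).Finite := by
  refine (((finite_statements M).prod Set.finite_univ).image _).union
    ((Set.Finite.pi' fun k => ?_).image _)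
  refine Set.Finite.subset
    (s := insert none (some '' (Sigma.mk k ⁻¹' symbols M k₀))) ?_ ?_
  · exact ((((finite_symbols M k₀).preimage sigma_mk_injective.injOn)).image _).insert _
  · rintro (_ | a) ho
    · exact Or.inl rfl
    · exact Or.inr ⟨a, ho a rfl, rfl⟩

/-- Only statements and symbols of the machine occur in a configuration. -/
def Admissible (M : Λ → Stmt A Λ σ) (k₀ : K) (c : Control A Λ σ × ∀ k, List (A k)) : Prop :=
  c.1.1 ∈ statements M ∧ ∀ k, ∀ a ∈ c.2 k, ⟨k, a⟩ ∈ symbols M k₀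

theorem Admissible.micro [DecidableEq K] {M : Λ → Stmt A Λ σ} {k₀ : K} {c : Control A Λ σ × ∀ k, List (A k)}
    (h : Admissible M k₀ c) : Admissible M k₀ (micro M c) := by
  obtain ⟨⟨q, v⟩, S⟩ := c
  refine ⟨nextControl_mem_statements h.1 _ _, ?_⟩
  cases q with
  | push k f q =>
    intro k' a ha
    simp only [StackTableau.micro, nextStacks] at ha
    rcases eq_or_ne k' k with rfl | hk
    · rw [Function.update_self, List.mem_cons] at ha
      rcases ha with rfl | ha
      · exact Or.inr ⟨_, h.1, v, rfl⟩
      · exact h.2 _ _ ha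
    · rw [Function.update_of_ne hk] at ha
      exact h.2 _ _ ha
  | pop k f q =>
    intro k' a ha
    simp only [StackTableau.micro, nextStacks] at ha
    rcases eq_or_ne k' k with rfl | hk
    · rw [Function.update_self] at ha
      exact h.2 _ _ (List.mem_of_mem_tail ha)
    · rw [Function.update_of_ne hk] at ha
      exact h.2 _ _ ha
  | _ => exact h.2

theorem Admissible.iterate_micro [DecidableEq K] {M : Λ → Stmt A Λ σ} {k₀ : K}
    {c : Control A Λ σ × ∀ k, List (A k)} (h : Admissible M k₀ c) (n : ℕ) :
    Admissible M k₀ ((StackTableau.micro M)^[n] c) := by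
  induction n with
  | zero => exact h
  | succ n ih =>
    rw [Function.iterate_succ_apply']
    exact ih.micro

theorem Admissible.cell_mem {M : Λ → Stmt A Λ σ} {k₀ : K}
    {c : Control A Λ σ × ∀ k, List (A k)} (h : Admissible M k₀ c) (p : ℕ) :
    cell c p ∈ cells M k₀ := by
  cases p with
  | zero => exact Or.inl ⟨c.1, ⟨h.1, trivial⟩, rfl⟩
  | succ p => exact Or.inr ⟨_, fun k a ha => h.2 k a (List.mem_of_getElem? ha), rfl⟩

/-! ### The tableau as an array -/

variable [DecidableEq K]

/-- The rows of length `P` of the tableau of a computation one after the other, after an additional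
blank cell. -/
def array (M : Λ → Stmt A Λ σ) (c : Control A Λ σ × ∀ k, List (A k)) (P j : ℕ) : Cell A Λ σ :=
  if j = 0 then .inr fun _ => none else cell ((micro M)^[(j - 1) / P] c) ((j - 1) % P)

theorem array_eq (M : Λ → Stmt A Λ σ) (c : Control A Λ σ × ∀ k, List (A k)) {P p : ℕ} (hp : p < P)
    (t : ℕ) : array M c P (1 + t * P + p) = cell ((micro M)^[t] c) p := by
  have h : 1 + t * P + p - 1 = p + P * t := by rw [mul_comm]; omega
  rw [array, if_neg (by omega), h, Nat.add_mul_div_left _ _ (by omega),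
    Nat.div_eq_of_lt hp, zero_add, Nat.add_mul_mod_self_left, Nat.mod_eq_of_lt hp]

/-- Concatenating the rows gives end cells wrong neighbours, harmlessly. The control cell ignores
its left neighbour. The last cell sees the next control cell, whose column counts as empty, and `ht`
makes the stacks too short to reach that depth. -/
theorem array_rule (M : Λ → Stmt A Λ σ) (c : Control A Λ σ × ∀ k, List (A k)) {P p t : ℕ}
    (hp : p < P) (ht : ∀ k, (c.2 k).length + t < P) :
    array M c P (1 + (t + 1) * P + p) =
      rule M (array M c P (1 + t * P)) (array M c P (t * P + p)) (array M c P (1 + t * P + p))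
        (array M c P (2 + t * P + p)) := by
  have h₀ := array_eq M c (p := 0) (by omega : 0 < P) t
  rw [add_zero] at h₀
  rw [array_eq M c hp, array_eq M c hp, h₀, Function.iterate_succ_apply']
  refine cell_micro M _ p _ _ ?_ ?_
  · rintro p' rfl
    rw [← array_eq M c (by omega : p' < P)]
    congr 1
    omega
  · rcases Nat.lt_or_ge (p + 1) P with h | h
    · rw [← array_eq M c h]
      congr 2
      omega
    · obtain rfl : P = p + 1 := by omega
      rw [show 2 + t * (p + 1) + p = 1 + (t + 1) * (p + 1) + 0 by rw [add_mul t 1]; omega,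
        array_eq M c (by omega)]
      funext k
      simp only [cell, Cell.column]
      refine (List.getElem?_eq_none ?_).symm
      have := length_iterate_micro_le M c k t
      have := ht k
      omega

open Computability Complexity in
/-- The computation of a predicate that is decidable in polynomial time is described by arrays with
finitely many entries that follow a local rule. -/
theorem exists_tableau {Γ : Type} [Fintype Γ] {R : List Γ × List Bool × List Bool → Bool}
    (hR : Nonempty (TM2ComputableInPolyTime encodeTriple encodeBool R)) :
    ∃ (V : Type) (vals : Finset V) (rule : V → V → V → V → V) (ctl blank : V)
      (sym : Γ ⊕ Bool ⊕ Bool → V) (acc : V → Prop) (b : Polynomial ℕ),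
      ctl ∈ vals ∧ blank ∈ vals ∧ (∀ a, sym a ∈ vals) ∧ ∀ x u v, ∀ B P : ℕ, b.eval (encodeTriple (x, u, v)).length ≤ B →
        (encodeTriple (x, u, v)).length + B + 1 < P →
        ∃ arr : ℕ → V, (∀ j, arr j ∈ vals) ∧ arr 0 = blank ∧ arr 1 = ctl ∧
          (∀ i a, (encodeTriple (x, u, v))[i]? = some a → arr (2 + i) = sym a) ∧
          (∀ i, (encodeTriple (x, u, v)).length ≤ i → i + 1 < P → arr (2 + i) = blank) ∧
          (∀ t < B, ∀ p < P, arr (1 + (t + 1) * P + p) =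
            rule (arr (1 + t * P)) (arr (t * P + p)) (arr (1 + t * P + p))
              (arr (2 + t * P + p))) ∧
          (acc (arr (2 + B * P)) ↔ R (x, u, v) = true) := by
  obtain ⟨⟨⟨tm, e₀, e₁⟩, τ, hτ⟩⟩ := hR
  have hK : Finite tm.K := @Finite.of_fintype _ tm.kFin
  have hΛ : Finite tm.Λ := @Finite.of_fintype _ tm.ΛFin
  have hσ : Finite tm.σ := @Finite.of_fintype _ tm.σFin
  have hA : Finite (tm.Γ tm.k₀) := @Finite.of_fintype _ tm.Γk₀Fin
  obtain ⟨d, hd⟩ : ∃ d, ∀ l, depth (tm.m l) ≤ d := by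
    obtain ⟨d, hd⟩ := (Set.finite_range fun l => depth (tm.m l)).bddAbove
    exact ⟨d, fun l => hd ⟨l, rfl⟩⟩
  -- The time bound is multiplied by `d`, the largest number of elementary instructions in a machine
  -- step. Acceptance reads the top of the output stack for the code of `true`.
  refine ⟨Cell tm.Γ tm.Λ tm.σ, (finite_cells tm.m tm.k₀).toFinset, rule tm.m,
    .inl (tm.m tm.main, tm.initialState), .inr fun _ => none,
    fun a => .inr (Function.update (fun _ => none) tm.k₀ (some (e₀.symm a))),
    fun c => c.column tm.k₁ = some (e₁.symm true), τ * Polynomial.C d, ?_, ?_, fun a => ?_,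
    fun x u v B P hB hP => ?_⟩
  · rw [Set.Finite.mem_toFinset]
    exact Or.inl ⟨_, ⟨Or.inr (Set.mem_iUnion.2 ⟨tm.main, stmts₁_self⟩), trivial⟩, rfl⟩
  · rw [Set.Finite.mem_toFinset]
    exact Or.inr ⟨_, fun k a ha => (by cases ha), rfl⟩
  · rw [Set.Finite.mem_toFinset]
    refine Or.inr ⟨_, fun k a' ha => ?_, rfl⟩
    rcases eq_or_ne k tm.k₀ with rfl | hk
    · exact Or.inl ⟨a', rfl⟩
    · rw [Function.update_of_ne hk] at ha
      cases ha
  set w := encodeTriple (x, u, v) with hw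
  set S : ∀ k, List (tm.Γ k) := Function.update (fun _ => []) tm.k₀ (w.map e₀.symm) with hS
  set c : Control tm.Γ tm.Λ tm.σ × ∀ k, List (tm.Γ k) := ((tm.m tm.main, tm.initialState), S)
    with hc
  have hlen : ∀ k, (S k).length ≤ w.length := by
    intro k
    rcases eq_or_ne k tm.k₀ with rfl | hk <;> simp [*]
  have hadm : Admissible tm.m tm.k₀ c := by
    refine ⟨Or.inr (Set.mem_iUnion.2 ⟨tm.main, stmts₁_self⟩), fun k a ha => ?_⟩
    rcases eq_or_ne k tm.k₀ with rfl | hk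
    · exact Or.inl ⟨a, rfl⟩
    · simp [hc, hS, hk] at ha
  have h₀ : ∀ i, i + 1 < P → array tm.m c P (2 + i) = .inr fun k => (S k)[i]? := by
    intro i hi
    have := array_eq tm.m c hi 0
    rw [show 2 + i = 1 + 0 * P + (i + 1) by omega, this]
    rfl
  refine ⟨array tm.m c P, ?_, ?_, ?_, ?_, ?_, ?_, ?_⟩
  · intro j
    rw [Set.Finite.mem_toFinset, array]
    split_ifs
    · exact Or.inr ⟨_, fun k a ha => (by cases ha), rfl⟩
    · exact (hadm.iterate_micro _).cell_mem _
  · simp [array]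
  · have := array_eq tm.m c (show 0 < P by omega) 0
    rwa [zero_mul, add_zero] at this
  · intro i a hi
    have hi' : i < w.length := (List.getElem?_eq_some_iff.1 hi).1
    rw [h₀ i (by omega)]
    congr 1
    funext k
    rcases eq_or_ne k tm.k₀ with rfl | hk
    · simp [hS, hi]
    · simp [hS, hk]
  · intro i hi hi'
    rw [h₀ i hi']
    congr 1
    funext k
    have := hlen k
    simp
    omega
  · intro t ht p hp
    refine array_rule tm.m c hp fun k => ?_
    have := hlen k
    simp only [hc]
    omega
  · obtain ⟨⟨n, hn⟩, hnm⟩ := hτ (x, u, v)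
    have hn' : (flip bind (step tm.m))^[n] (some ⟨some tm.main, tm.initialState, S⟩) =
        some ⟨none, tm.initialState,
          Function.update (fun _ => []) tm.k₁ [e₁.symm (R (x, u, v))]⟩ := by
      have := haltList_eq tm [e₁.symm (R (x, u, v))]
      rw [← this]
      have := initList_eq tm (w.map e₀.symm)
      rw [hS, ← this]
      exact hn
    obtain ⟨j, hj, hjc⟩ := exists_micro_iterate tm.m hd n _ _ hn'
    have hjB : j ≤ B := by
      refine (hj.trans (Nat.mul_le_mul_right d hnm)).trans (le_trans (le_of_eq ?_) hB)
      simp [hw]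
    -- A halted run stays put under `micro`, so row `B` shows the final configuration even if
    -- halting happened earlier.
    have hfin : (micro tm.m)^[B] c = ((.halt, tm.initialState),
        Function.update (fun _ => []) tm.k₁ [e₁.symm (R (x, u, v))]) := by
      rw [show B = (B - j) + j by omega, Function.iterate_add_apply]
      exact (congrArg _ hjc).trans (iterate_micro_halt _ _ _ _)
    rw [show 2 + B * P = 1 + B * P + 1 by omega, array_eq tm.m c (by omega), hfin]
    simp [cell, Cell.column]

end StackTableau

/-! ## The instance of IN-MINTRAP that describes a tableau -/

namespace TableauReduction

open BooleanNetwork Complexity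

/-- The data of the tableaux of a computation: the finitely many contents of the cells, the local
rule, the first cell, the blank cell, the cells of the input symbols, and the accepting cells. -/
structure Tableau (Γ : Type) where
  {V : Type}
  vals : List V
  rule : V → V → V → V → V
  ctl : V
  blank : V
  sym : Γ ⊕ Bool ⊕ Bool → V
  acc : V → Prop
  ctl_mem : ctl ∈ vals
  blank_mem : blank ∈ vals
  sym_mem : ∀ a, sym a ∈ vals

/-- The length of a row. -/
def rowLen (N Q B : ℕ) : ℕ := N + 2 * Q + B + 2

/-- The number of cells. -/
def cellCount (N Q B : ℕ) : ℕ := (B + 1) * rowLen N Q B + 1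

open scoped Classical in
/-- The variable for the content `v` of the cell `j`. -/
noncomputable def cellVar {V : Type} (vals : List V) (j : ℕ) (v : V) : ℕ :=
  1 + vals.length * j + vals.idxOf v

/-- The first variable of the certificates. -/
def certVar {V : Type} (vals : List V) (N Q B : ℕ) : ℕ := 1 + vals.length * cellCount N Q B

variable {Γ : Type} (T : Tableau Γ)

namespace Tableau

/-- The cell `j` has content `v`. -/
noncomputable def is (j : ℕ) (v : T.V) : Formula := .var (cellVar T.vals j v)

/-- The cell `j` has the content for the bit in a variable. -/
noncomputable def bitClauses (j i : ℕ) (f : Bool → Γ ⊕ Bool ⊕ Bool) : List Formula :=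
  [.imp (.var i) (T.is j (T.sym (f true))), .imp (.neg (.var i)) (T.is j (T.sym (f false)))]

open scoped Classical in
/-- The local rule for a cell `j'` of the next row. -/
noncomputable def ruleClauses (j₀ j j' : ℕ) : List Formula :=
  T.vals.flatMap fun a => T.vals.flatMap fun b => T.vals.flatMap fun c => T.vals.flatMap fun d =>
    if T.rule a b c d ∈ T.vals then
      [.imp (T.is j₀ a) (.imp (T.is j b) (.imp (T.is (j + 1) c) (.imp (T.is (j + 2) d)
        (T.is j' (T.rule a b c d)))))]
    else []

/-- The first row contains the input. -/
noncomputable def inputClauses (x : List Γ) : List Formula :=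
  x.zipIdx.flatMap fun a => [T.is (2 + a.2) (T.sym (.inl a.1))]

open scoped Classical in
/-- The remaining clauses: the rest of the first row, the local rule, and acceptance. -/
noncomputable def clauses (N Q B : ℕ) : List Formula :=
  [T.is 0 T.blank, T.is 1 T.ctl] ++
  ((List.range Q).flatMap fun i => T.bitClauses (2 + N + i) (certVar T.vals N Q B + i)
    fun b => .inr (.inl b)) ++
  ((List.range Q).flatMap fun i => T.bitClauses (2 + N + Q + i) (certVar T.vals N Q B + Q + i)
    fun b => .inr (.inr b)) ++
  ((List.range (B + 1)).flatMap fun i => [T.is (2 + N + 2 * Q + i) T.blank]) ++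
  ((List.range B).flatMap fun t => (List.range (rowLen N Q B)).flatMap fun p =>
    T.ruleClauses (1 + t * rowLen N Q B) (t * rowLen N Q B + p)
      (1 + (t + 1) * rowLen N Q B + p)) ++
  (T.vals.filter fun v => ¬ T.acc v).flatMap fun v => [.neg (T.is (2 + B * rowLen N Q B) v)]

/-- The formula stating that the tableau is correct and accepting. -/
noncomputable def formula (x : List Γ) (Q B : ℕ) : Formula :=
  .conj (T.inputClauses x ++ T.clauses x.length Q B)

variable {T}

theorem eval_bitClauses (s : ℕ → Bool) (j i : ℕ) (f : Bool → Γ ⊕ Bool ⊕ Bool) :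
    (∀ φ ∈ T.bitClauses j i f, φ.eval s = true) ↔ (T.is j (T.sym (f (s i)))).eval s = true := by
  simp only [bitClauses, List.mem_cons, List.not_mem_nil, or_false, forall_eq_or_imp, forall_eq,
    Formula.eval_imp]
  cases h : s i <;> simp [Formula.eval, h]

open scoped Classical in
-- Membership of the rule's value in `T.vals` is needed: a foreign value has index `T.vals.length`,
-- and its variable would collide with the first variable of the next cell.
theorem eval_ruleClauses (s : ℕ → Bool) (j₀ j j' : ℕ) :
    (∀ φ ∈ T.ruleClauses j₀ j j', φ.eval s = true) ↔
      ∀ a ∈ T.vals, ∀ b ∈ T.vals, ∀ c ∈ T.vals, ∀ d ∈ T.vals, T.rule a b c d ∈ T.vals →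
        (T.is j₀ a).eval s = true → (T.is j b).eval s = true →
        (T.is (j + 1) c).eval s = true → (T.is (j + 2) d).eval s = true →
        (T.is j' (T.rule a b c d)).eval s = true := by
  have h : ∀ (a b c d : T.V) (φ : Formula), φ ∈ (if T.rule a b c d ∈ T.vals then
      [Formula.imp (T.is j₀ a) (.imp (T.is j b) (.imp (T.is (j + 1) c) (.imp (T.is (j + 2) d)
        (T.is j' (T.rule a b c d)))))]
    else []) ↔ T.rule a b c d ∈ T.vals ∧ φ = Formula.imp (T.is j₀ a) (.imp (T.is j b)
      (.imp (T.is (j + 1) c) (.imp (T.is (j + 2) d) (T.is j' (T.rule a b c d))))) := by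
    intro a b c d φ
    split_ifs with h <;> simp [h]
  simp only [ruleClauses, List.mem_flatMap, h]
  constructor
  · intro H a ha b hb c hc d hd hr
    simpa only [Formula.eval_imp] using H _ ⟨a, ha, b, hb, c, hc, d, hd, hr, rfl⟩
  · rintro H φ ⟨a, ha, b, hb, c, hc, d, hd, hr, rfl⟩
    simpa only [Formula.eval_imp] using H a ha b hb c hc d hd hr

theorem eval_formula (s : ℕ → Bool) (x : List Γ) (Q B : ℕ) :
    (T.formula x Q B).eval s = true ↔
      (∀ i a, x[i]? = some a → (T.is (2 + i) (T.sym (.inl a))).eval s = true) ∧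
      (T.is 0 T.blank).eval s = true ∧ (T.is 1 T.ctl).eval s = true ∧
      (∀ i < Q, (T.is (2 + x.length + i)
        (T.sym (.inr (.inl (s (certVar T.vals x.length Q B + i)))))).eval s = true) ∧
      (∀ i < Q, (T.is (2 + x.length + Q + i)
        (T.sym (.inr (.inr (s (certVar T.vals x.length Q B + Q + i)))))).eval s = true) ∧
      (∀ i < B + 1, (T.is (2 + x.length + 2 * Q + i) T.blank).eval s = true) ∧
      (∀ t < B, ∀ p < rowLen x.length Q B, ∀ a ∈ T.vals, ∀ b ∈ T.vals, ∀ c ∈ T.vals, ∀ d ∈ T.vals,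
        T.rule a b c d ∈ T.vals →
        (T.is (1 + t * rowLen x.length Q B) a).eval s = true →
        (T.is (t * rowLen x.length Q B + p) b).eval s = true →
        (T.is (t * rowLen x.length Q B + p + 1) c).eval s = true →
        (T.is (t * rowLen x.length Q B + p + 2) d).eval s = true →
        (T.is (1 + (t + 1) * rowLen x.length Q B + p) (T.rule a b c d)).eval s = true) ∧
      (∀ v ∈ T.vals, ¬ T.acc v → (T.is (2 + B * rowLen x.length Q B) v).eval s = false) := by
  classical
  rw [formula, Formula.eval_conj]
  simp only [clauses, inputClauses, List.forall_mem_append, List.forall_mem_flatMap,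
    List.forall_mem_cons, List.mem_filter, List.mem_range, eval_bitClauses,
    eval_ruleClauses, Formula.eval, and_assoc, List.not_mem_nil, false_implies, implies_true,
    and_true, decide_eq_true_eq, Bool.not_eq_true', and_imp, Prod.forall,
    List.mk_mem_zipIdx_iff_getElem?]
  exact and_congr_left fun _ => forall_comm

/-- The array describes a correct computation of `B` steps on the input `w`, in rows of length
`P`. -/
structure Describes (T : Tableau Γ) (w : List (Γ ⊕ Bool ⊕ Bool)) (B P : ℕ) (arr : ℕ → T.V) :
    Prop where
  mem : ∀ j, arr j ∈ T.vals
  zero : arr 0 = T.blank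
  one : arr 1 = T.ctl
  input : ∀ i a, w[i]? = some a → arr (2 + i) = T.sym a
  blank : ∀ i, w.length ≤ i → i + 1 < P → arr (2 + i) = T.blank
  rule : ∀ t < B, ∀ p < P, arr (1 + (t + 1) * P + p) =
    T.rule (arr (1 + t * P)) (arr (t * P + p)) (arr (1 + t * P + p)) (arr (2 + t * P + p))

/-- The input and the two certificates given by the values of the variables. -/
def word (x : List Γ) (Q U : ℕ) (s : ℕ → Bool) : List (Γ ⊕ Bool ⊕ Bool) :=
  encodeTriple (x, (List.range Q).map (fun i => s (U + i)),
    (List.range Q).map fun i => s (U + Q + i))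

theorem length_word (x : List Γ) (Q U : ℕ) (s : ℕ → Bool) :
    (word x Q U s).length = x.length + 2 * Q := by
  simp [word, encodeTriple]
  omega

theorem word_getElem?_input {x : List Γ} {i : ℕ} {a : Γ} (h : x[i]? = some a) (Q U : ℕ)
    (s : ℕ → Bool) : (word x Q U s)[i]? = some (.inl a) := by
  have hi : i < x.length := (List.getElem?_eq_some_iff.1 h).1
  rw [word, encodeTriple, List.append_assoc, List.getElem?_append_left (by simpa using hi)]
  simp [h]

theorem word_getElem?_fst (x : List Γ) {i Q : ℕ} (h : i < Q) (U : ℕ) (s : ℕ → Bool) :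
    (word x Q U s)[x.length + i]? = some (.inr (.inl (s (U + i)))) := by
  rw [word, encodeTriple, List.append_assoc, List.getElem?_append_right (by simp),
    List.getElem?_append_left (by simpa using h)]
  simp [h]

theorem word_getElem?_snd (x : List Γ) {i Q : ℕ} (h : i < Q) (U : ℕ) (s : ℕ → Bool) :
    (word x Q U s)[x.length + Q + i]? = some (.inr (.inr (s (U + Q + i)))) := by
  rw [word, encodeTriple, List.getElem?_append_right (by simp)]
  simp only [List.length_append, List.length_map, List.length_range, Nat.add_sub_cancel_left]
  simp [h]

/-- A satisfying assignment of the formula makes the entries of the array true. -/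
theorem eval_is_of_describes {s : ℕ → Bool} {x : List Γ} {Q B : ℕ}
    (hs : (T.formula x Q B).eval s = true) {arr : ℕ → T.V}
    (h : Describes T (word x Q (certVar T.vals x.length Q B) s) B (rowLen x.length Q B) arr)
    (j : ℕ) (hj : j ≤ (B + 1) * rowLen x.length Q B) : (T.is j (arr j)).eval s = true := by
  obtain ⟨h₁, h₂, h₃, h₄, h₅, h₆, h₇, -⟩ := (eval_formula s x Q B).1 hs
  induction j using Nat.strong_induction_on with
  | _ j ih =>
  set P := rowLen x.length Q B with hP
  have hP' : P = x.length + 2 * Q + B + 2 := rfl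
  rcases Nat.lt_or_ge P j with hPj | hPj
  · obtain ⟨t, p, hp, rfl⟩ : ∃ t p, p < P ∧ j = 1 + (t + 1) * P + p := by
      -- The subtraction inside accounts for the extra blank cell at index `0`; the one outside
      -- passes to the preceding row, whose cells have smaller indices.
      refine ⟨(j - 1) / P - 1, (j - 1) % P, Nat.mod_lt _ (by omega), ?_⟩
      have h₁ : 1 ≤ (j - 1) / P := (Nat.one_le_div_iff (by omega)).2 (by omega)
      have h₂ := Nat.div_add_mod' (j - 1) P
      rw [show (j - 1) / P - 1 + 1 = (j - 1) / P by omega]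
      omega
    have ht : t < B := by
      by_contra hcon
      have : (B + 1) * P ≤ (t + 1) * P := Nat.mul_le_mul_right _ (by omega)
      omega
    have hadd : (t + 1) * P = t * P + P := by ring
    rw [h.rule t ht p hp]
    refine h₇ t ht p hp _ (h.mem _) _ (h.mem _) _ (h.mem _) _ (h.mem _) ?_ ?_ ?_ ?_ ?_
    · rw [← h.rule t ht p hp]
      exact h.mem _
    · exact ih _ (by omega) (by omega)
    · exact ih _ (by omega) (by omega)
    · rw [show t * P + p + 1 = 1 + t * P + p by omega]
      exact ih _ (by omega) (by omega)
    · rw [show t * P + p + 2 = 2 + t * P + p by omega]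
      exact ih _ (by omega) (by omega)
  · obtain rfl | rfl | hj2 : j = 0 ∨ j = 1 ∨ 2 ≤ j := by omega
    · rwa [h.zero]
    · rwa [h.one]
    obtain ⟨i, rfl⟩ := Nat.exists_eq_add_of_le hj2
    rcases Nat.lt_or_ge i x.length with hi | hi
    · have hx : x[i]? = some x[i] := List.getElem?_eq_getElem hi
      rw [h.input i _ (word_getElem?_input hx _ _ _)]
      exact h₁ i _ hx
    obtain ⟨i, rfl⟩ := Nat.exists_eq_add_of_le hi
    rcases Nat.lt_or_ge i Q with hi' | hi'
    · rw [h.input _ _ (word_getElem?_fst x hi' _ _), ← add_assoc]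
      exact h₄ i hi'
    obtain ⟨i, rfl⟩ := Nat.exists_eq_add_of_le hi'
    rcases Nat.lt_or_ge i Q with hi'' | hi''
    · rw [← add_assoc x.length, h.input _ _ (word_getElem?_snd x hi'' _ _), ← add_assoc,
        ← add_assoc]
      exact h₅ i hi''
    obtain ⟨i, rfl⟩ := Nat.exists_eq_add_of_le hi''
    rw [h.blank _ (by rw [length_word]; omega) (by omega),
      show 2 + (x.length + (Q + (Q + i))) = 2 + x.length + 2 * Q + i by omega]
    exact h₆ i (by omega)

/-- The assignment that describes a correct accepting computation satisfies the formula. -/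
theorem eval_formula_of_describes {s : ℕ → Bool} {x : List Γ} {Q B : ℕ} {arr : ℕ → T.V}
    (h : Describes T (word x Q (certVar T.vals x.length Q B) s) B (rowLen x.length Q B) arr)
    (hs : ∀ j ≤ (B + 1) * rowLen x.length Q B, ∀ v ∈ T.vals,
      s (cellVar T.vals j v) = true ↔ arr j = v)
    (hacc : T.acc (arr (2 + B * rowLen x.length Q B))) : (T.formula x Q B).eval s = true := by
  have hP : rowLen x.length Q B = x.length + 2 * Q + B + 2 := rfl
  have hBP : (B + 1) * rowLen x.length Q B = B * rowLen x.length Q B + rowLen x.length Q B := by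
    ring
  have hle : rowLen x.length Q B ≤ (B + 1) * rowLen x.length Q B := by omega
  have key : ∀ j ≤ (B + 1) * rowLen x.length Q B, ∀ v, arr j = v → (T.is j v).eval s = true := by
    rintro j hj v rfl
    exact (hs j hj _ (h.mem j)).2 rfl
  refine (eval_formula s x Q B).2 ⟨?_, ?_, ?_, ?_, ?_, ?_, ?_, ?_⟩
  · intro i a hi
    have : i < x.length := (List.getElem?_eq_some_iff.1 hi).1
    exact key _ (by omega) _ (h.input _ _ (word_getElem?_input hi _ _ _))
  · exact key _ (Nat.zero_le _) _ h.zero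
  · exact key _ (by omega) _ h.one
  · intro i hi
    exact key _ (by omega) _ (by rw [add_assoc]; exact h.input _ _ (word_getElem?_fst x hi _ _))
  · intro i hi
    refine key _ (by omega) _ ?_
    rw [add_assoc, add_assoc, ← add_assoc x.length]
    exact h.input _ _ (word_getElem?_snd x hi _ _)
  · intro i hi
    refine key _ (by omega) _ ?_
    rw [show 2 + x.length + 2 * Q + i = 2 + (x.length + 2 * Q + i) by omega]
    exact h.blank _ (by rw [length_word]; omega) (by omega)
  · intro t ht p hp a ha b hb c hc d hd _ h₁ h₂ h₃ h₄
    have hle : (t + 1) * rowLen x.length Q B ≤ B * rowLen x.length Q B :=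
      Nat.mul_le_mul_right _ ht
    have hadd : (t + 1) * rowLen x.length Q B = t * rowLen x.length Q B + rowLen x.length Q B := by
      ring
    have h₁' := (hs _ (by omega) a ha).1 h₁
    have h₂' := (hs _ (by omega) b hb).1 h₂
    have h₃' := (hs _ (by omega) c hc).1 h₃
    have h₄' := (hs _ (by omega) d hd).1 h₄
    refine key _ (by omega) _ ?_
    rw [h.rule t ht p hp, h₁', h₂', show 1 + t * rowLen x.length Q B + p =
      t * rowLen x.length Q B + p + 1 by omega, show 2 + t * rowLen x.length Q B + p =
      t * rowLen x.length Q B + p + 2 by omega, h₃', h₄']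
  · intro v hv hna
    by_contra hcon
    rw [Bool.not_eq_false] at hcon
    exact hna ((hs _ (by omega) v hv).1 hcon ▸ hacc)

/-! ### The Boolean network -/

/-- The number of variables. -/
def dim (T : Tableau Γ) (N Q B : ℕ) : ℕ := certVar T.vals N Q B + 2 * Q

open scoped Classical in
/-- The local functions of the Boolean network: the first variable is the control. -/
noncomputable def localFormula (x : List Γ) (Q B i : ℕ) : Formula :=
  if i = 0 then .and (.neg (.var 0)) (T.formula x Q B)
  else if certVar T.vals x.length Q B ≤ i ∧ i < certVar T.vals x.length Q B + Q then
    .xor (.var 0) (.var i)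
  else .neg (.var i)

instance (N Q B : ℕ) : NeZero (dim T N Q B) := ⟨by simp [dim, certVar]⟩

/-- This is `inMinTrap_iff_forall_exists` with control `0` and `U` the first-certificate variables.
A model of the formula contains the genuine tableau of its certificates, which must therefore
accept; conversely an accepting tableau supplies a model. -/
theorem inMinTrap_iff {x : List Γ} {Q B : ℕ}
    {R : List Γ × List Bool × List Bool → Bool}
    (hT : ∀ u v : List Bool, u.length = Q → v.length = Q → ∃ arr,
      Describes T (encodeTriple (x, u, v)) B (rowLen x.length Q B) arr ∧
      (T.acc (arr (2 + B * rowLen x.length Q B)) ↔ R (x, u, v) = true)) :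
    InMinTrap (ofFormulas fun i : Fin (dim T x.length Q B) =>
        (T.localFormula x Q B i).toProp (dim T x.length Q B)) (fun _ => true) ↔
      ∀ u : List Bool, u.length = Q → ∃ v : List Bool, v.length = Q ∧ R (x, u, v) = true := by
  set n := dim T x.length Q B with hn
  set U := certVar T.vals x.length Q B with hU
  have hn' : n = U + 2 * Q := rfl
  have hU' : U = 1 + T.vals.length * ((B + 1) * rowLen x.length Q B + 1) := rfl
  have hU0 : 0 < U := by omega
  obtain ⟨e, he, hev⟩ : ∃ e : ℕ → Fin n, (∀ i < n, (e i : ℕ) = i) ∧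
      ∀ (φ : Formula) (y : Config n), (φ.toProp n).eval y = φ.eval fun i => y (e i) :=
    ⟨Fin.ofNat n, fun i hi => Nat.mod_eq_of_lt hi, Formula.eval_toProp⟩
  have hval : ∀ i : Fin n, e i = i := fun i => Fin.ext (he i i.2)
  have hwval : (e 0 : ℕ) = 0 := he 0 (by omega)
  have hbp : 2 + B * rowLen x.length Q B ≤ (B + 1) * rowLen x.length Q B := by
    have : rowLen x.length Q B = x.length + 2 * Q + B + 2 := rfl
    rw [add_mul]
    omega
  rw [inMinTrap_iff_forall_exists _
    (fun y => (T.formula x Q B).eval fun i => y (e i)) (e 0)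
    {i | U ≤ i ∧ (i : ℕ) < U + Q} (by simp [hwval]; omega)
    (by
      intro y
      refine (hev _ y).trans ?_
      rw [localFormula, if_pos hwval]
      rfl)
    (by
      rintro y i ⟨hi, hi'⟩
      refine (hev _ y).trans ?_
      rw [localFormula, if_neg (by omega), if_pos ⟨hi, hi'⟩]
      simp [Formula.eval, hval])
    (by
      intro y i hi hi'
      refine (hev _ y).trans ?_
      rw [localFormula, if_neg (fun h => hi (Fin.ext (h.trans hwval.symm))),
        if_neg (show ¬ (U ≤ (i : ℕ) ∧ (i : ℕ) < U + Q) from hi')]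
      simp [Formula.eval, hval])
    _ rfl]
  constructor
  · intro H u hu
    -- Below `U` the truncated difference `i - U` is `0` and would read the first bit of `u`; the
    -- factor `decide (U ≤ i)` keeps the control off.
    obtain ⟨y, hy0, hyu, hy⟩ := H (fun i => u.getD (i - U) false && decide (U ≤ i)) (by
      simp [hwval]; omega)
    set s : ℕ → Bool := fun i => y (e i) with hs
    refine ⟨(List.range Q).map fun i => s (U + Q + i), by simp, ?_⟩
    have hsu : (List.range Q).map (fun i => s (U + i)) = u := by
      refine List.ext_getElem (by simp [hu]) fun i h₁ h₂ => ?_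
      have hi : i < Q := by simpa using h₁
      have hlt := he (U + i) (by omega)
      have := hyu (e (U + i)) (by simp [hlt, hi])
      simp [hs, this, hlt, h₂]
    obtain ⟨arr, harr, hacc⟩ := hT ((List.range Q).map fun i => s (U + i))
      ((List.range Q).map fun i => s (U + Q + i)) (by simp) (by simp)
    rw [hsu] at hacc
    rw [← hacc]
    by_contra hcon
    have h₁ := eval_is_of_describes hy harr (2 + B * rowLen x.length Q B) hbp
    have h₂ := ((eval_formula s x Q B).1 hy).2.2.2.2.2.2.2 _ (harr.mem _) hcon
    rw [h₁] at h₂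
    cases h₂
  · classical
    intro H y hy0
    obtain ⟨v, hv, hR⟩ := H ((List.range Q).map fun i => y (e (U + i))) (by simp)
    obtain ⟨arr, harr, hacc⟩ := hT ((List.range Q).map fun i => y (e (U + i))) v (by simp) hv
    set m := T.vals.length with hm
    -- A tableau variable is `1 + m * j + k` for cell `j` and content number `k`, so quotient and
    -- remainder of `i - 1` by `m` recover the pair. Only the content prescribed by `arr` is marked.
    set y' : Config n := fun i => if (i : ℕ) = 0 then false
      else if (i : ℕ) < U then decide (T.vals.idxOf (arr ((i - 1) / m)) = (i - 1) % m)
      else if (i : ℕ) < U + Q then y i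
      else v.getD (i - (U + Q)) false with hy'
    refine ⟨y', if_pos hwval, ?_, ?_⟩
    · rintro i ⟨hi, hi'⟩
      simp only [hy']
      rw [if_neg (by omega), if_neg (by omega), if_pos hi']
    · refine eval_formula_of_describes (arr := arr) ?_ ?_ (hacc.2 hR)
      · convert harr using 1
        simp only [word]
        congr 3
        · refine List.map_congr_left fun i hi => ?_
          rw [List.mem_range] at hi
          have hlt := he (U + i) (by omega)
          simp only [hy', ← hU, hlt]
          rw [if_neg (by omega), if_neg (by omega), if_pos (by omega)]
        · refine List.ext_getElem (by simp [hv]) fun i h₁ h₂ => ?_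
          have hi : i < Q := by simpa using h₁
          have hlt := he (U + Q + i) (by omega)
          simp only [List.getElem_map, List.getElem_range, hy', ← hU, hlt]
          rw [if_neg (by omega), if_neg (by omega), if_neg (by omega)]
          simp [h₂]
      · intro j hj a ha
        have hlt : T.vals.idxOf a < m := List.idxOf_lt_length_iff.2 ha
        have hcv : cellVar T.vals j a = 1 + (m * j + T.vals.idxOf a) := by
          rw [cellVar, ← hm, add_assoc]
        have hle : m * j + m ≤ m * ((B + 1) * rowLen x.length Q B + 1) := by
          rw [← mul_add_one]
          exact Nat.mul_le_mul_left _ (by omega)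
        have hmod := he (1 + (m * j + T.vals.idxOf a)) (by omega)
        simp only [hy', hcv, hmod]
        rw [if_neg (by omega), if_pos (by omega), Nat.add_sub_cancel_left, Nat.mul_add_div (by omega),
          Nat.div_eq_of_lt hlt, add_zero, Nat.mul_add_mod, Nat.mod_eq_of_lt hlt, decide_eq_true_eq]
        exact List.idxOf_inj (harr.mem j)

end Tableau

end TableauReduction

namespace TableauReduction

open BooleanNetwork Complexity StackProg

variable {Γ : Type}

/-! ### The variables of the formulas -/

namespace Tableau

variable {T : Tableau Γ}

theorem varsLt_is {N Q B j : ℕ} {v : T.V} (hv : v ∈ T.vals) (hj : j ≤ (B + 1) * rowLen N Q B) :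
    (T.is j v).VarsLt (dim T N Q B) := by
  classical
  have h : T.vals.idxOf v < T.vals.length := List.idxOf_lt_length_iff.2 hv
  have hle : T.vals.length * j + T.vals.length ≤
      T.vals.length * ((B + 1) * rowLen N Q B + 1) := by
    rw [← mul_add_one]
    exact Nat.mul_le_mul_left _ (by omega)
  simp only [is, Formula.VarsLt, cellVar, dim, certVar, cellCount]
  omega

/-- Needed so that passing to `n` variables by reduction modulo `n` leaves the encoded word
unchanged. -/
theorem varsLt_formula (x : List Γ) (Q B : ℕ) :
    (T.formula x Q B).VarsLt (dim T x.length Q B) := by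
  classical
  refine Formula.varsLt_conj (Nat.pos_of_ne_zero (NeZero.ne _)) ?_
  set n := dim T x.length Q B with hn
  have hn' : n = certVar T.vals x.length Q B + 2 * Q := rfl
  have hP : rowLen x.length Q B = x.length + 2 * Q + B + 2 := rfl
  have hBP : (B + 1) * rowLen x.length Q B = B * rowLen x.length Q B + rowLen x.length Q B := by
    ring
  have bit : ∀ (j i : ℕ) (f : Bool → Γ ⊕ Bool ⊕ Bool), i < n → j ≤ (B + 1) * rowLen x.length Q B →
      ∀ φ ∈ T.bitClauses j i f, φ.VarsLt n := by
    intro j i f hi hj φ hφ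
    simp only [bitClauses, List.mem_cons, List.not_mem_nil, or_false] at hφ
    rcases hφ with rfl | rfl
    · exact ⟨hi, varsLt_is (T.sym_mem _) hj⟩
    · exact ⟨hi, varsLt_is (T.sym_mem _) hj⟩
  simp only [clauses, inputClauses, List.forall_mem_append, List.forall_mem_flatMap,
    List.forall_mem_cons, List.mem_filter, List.mem_range, List.not_mem_nil, false_implies,
    implies_true, and_true, and_imp, Prod.forall, List.mk_mem_zipIdx_iff_getElem?]
  refine ⟨?_, ⟨⟨⟨⟨⟨⟨?_, ?_⟩, ?_⟩, ?_⟩, ?_⟩, ?_⟩, ?_⟩⟩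
  · intro a i hi
    have : i < x.length := (List.getElem?_eq_some_iff.1 hi).1
    exact varsLt_is (T.sym_mem _) (by omega)
  · exact varsLt_is T.blank_mem (Nat.zero_le _)
  · exact varsLt_is T.ctl_mem (by omega)
  · exact fun i hi => bit _ _ _ (by omega) (by omega)
  · exact fun i hi => bit _ _ _ (by omega) (by omega)
  · exact fun i hi => varsLt_is T.blank_mem (by omega)
  · intro t ht p hp φ hφ
    have h₁ : (t + 1) * rowLen x.length Q B = t * rowLen x.length Q B + rowLen x.length Q B := by
      ring
    have h₂ : (t + 1) * rowLen x.length Q B ≤ B * rowLen x.length Q B := Nat.mul_le_mul_right _ ht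
    simp only [ruleClauses, List.mem_flatMap] at hφ
    obtain ⟨a, ha, b, hb, c, hc, d, hd, hφ⟩ := hφ
    split_ifs at hφ with hr
    · rw [List.mem_singleton.1 hφ]
      exact ⟨varsLt_is ha (by omega), varsLt_is hb (by omega), varsLt_is hc (by omega),
        varsLt_is hd (by omega), varsLt_is hr (by omega)⟩
    · simp at hφ
  · exact fun v hv _ => varsLt_is (T := T) hv (by omega)

/-! ### Writing the formulas -/

end Tableau

instance : Inhabited Sym := ⟨.tick⟩

/-- A list of clauses can be written in polynomial time, as a beginning of a conjunction. -/
def EmitClauses (Γ : Type) (d : ℕ) (L : (ℕ → ℕ) → List Formula) : Prop :=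
  Emit Γ d fun ρ => (L ρ).flatMap fun φ => Sym.and :: φ.encode

theorem emit_var {d : ℕ} {e : (ℕ → ℕ) → ℕ} (he : Num Γ Sym d e) :
    Emit Γ d fun ρ => (Formula.var (e ρ)).encode :=
  (he.emit Sym.tick).append (emit_const d [Sym.var])

theorem emit_neg {d : ℕ} {φ : (ℕ → ℕ) → Formula} (h : Emit Γ d fun ρ => (φ ρ).encode) :
    Emit Γ d fun ρ => (Formula.neg (φ ρ)).encode :=
  (emit_const d [Sym.neg]).append h

theorem emit_and {d : ℕ} {φ ψ : (ℕ → ℕ) → Formula} (h : Emit Γ d fun ρ => (φ ρ).encode)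
    (h' : Emit Γ d fun ρ => (ψ ρ).encode) : Emit Γ d fun ρ => (Formula.and (φ ρ) (ψ ρ)).encode :=
  (emit_const d [Sym.and]).append (h.append h')

theorem emit_or {d : ℕ} {φ ψ : (ℕ → ℕ) → Formula} (h : Emit Γ d fun ρ => (φ ρ).encode)
    (h' : Emit Γ d fun ρ => (ψ ρ).encode) : Emit Γ d fun ρ => (Formula.or (φ ρ) (ψ ρ)).encode :=
  (emit_const d [Sym.or]).append (h.append h')

theorem emit_imp {d : ℕ} {φ ψ : (ℕ → ℕ) → Formula} (h : Emit Γ d fun ρ => (φ ρ).encode)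
    (h' : Emit Γ d fun ρ => (ψ ρ).encode) : Emit Γ d fun ρ => (Formula.imp (φ ρ) (ψ ρ)).encode :=
  emit_or (emit_neg h) h'

theorem emit_xor {d : ℕ} {φ ψ : (ℕ → ℕ) → Formula} (h : Emit Γ d fun ρ => (φ ρ).encode)
    (h' : Emit Γ d fun ρ => (ψ ρ).encode) : Emit Γ d fun ρ => (Formula.xor (φ ρ) (ψ ρ)).encode :=
  emit_or (emit_and h (emit_neg h')) (emit_and (emit_neg h) h')

theorem emitClauses_nil (d : ℕ) : EmitClauses Γ d fun _ => [] := emit_const d []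

theorem EmitClauses.append {d : ℕ} {L L' : (ℕ → ℕ) → List Formula} (h : EmitClauses Γ d L)
    (h' : EmitClauses Γ d L') : EmitClauses Γ d fun ρ => L ρ ++ L' ρ := by
  simp only [EmitClauses, List.flatMap_append]
  exact Emit.append h h'

theorem emitClauses_singleton {d : ℕ} {φ : (ℕ → ℕ) → Formula}
    (h : Emit Γ d fun ρ => (φ ρ).encode) : EmitClauses Γ d fun ρ => [φ ρ] := by
  simp only [EmitClauses, List.flatMap_singleton]
  exact (emit_const d [Sym.and]).append h

theorem EmitClauses.flatMap_range {d : ℕ} {e : (ℕ → ℕ) → ℕ} {L : (ℕ → ℕ) → List Formula}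
    (he : Num Γ Sym d e) (h : EmitClauses Γ (d + 1) L) :
    EmitClauses Γ d fun ρ => (List.range (e ρ)).flatMap fun m => L (Function.update ρ d m) := by
  simp only [EmitClauses, List.flatMap_assoc]
  exact Emit.flatMap_range he h

theorem emitClauses_flatMap {ι : Type} {d : ℕ} (l : List ι) {L : ι → (ℕ → ℕ) → List Formula}
    (h : ∀ a ∈ l, EmitClauses Γ d (L a)) :
    EmitClauses Γ d fun ρ => l.flatMap fun a => L a ρ := by
  simp only [EmitClauses, List.flatMap_assoc]
  exact emit_flatMap l h

namespace Tableau

variable (T : Tableau Γ)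

theorem emit_is {d : ℕ} {e : (ℕ → ℕ) → ℕ} (he : Num Γ Sym d e) (v : T.V) :
    Emit Γ d fun ρ => (T.is (e ρ) v).encode :=
  emit_var (((num_const d 1).add ((num_const d _).mul he)).add (num_const d _))

theorem emitClauses_bit {d : ℕ} {e e' : (ℕ → ℕ) → ℕ} (he : Num Γ Sym d e) (he' : Num Γ Sym d e')
    (f : Bool → Γ ⊕ Bool ⊕ Bool) : EmitClauses Γ d fun ρ => T.bitClauses (e ρ) (e' ρ) f :=
  (emitClauses_singleton (emit_imp (emit_var he') (T.emit_is he _))).append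
    (emitClauses_singleton (emit_imp (emit_neg (emit_var he')) (T.emit_is he _)))

/-- The loops over cell contents do not depend on the input and are unrolled in the program. The
rule and the membership tests are thus hard-wired, and no computability of them is required. -/
theorem emitClauses_rule {d : ℕ} {e₀ e e' : (ℕ → ℕ) → ℕ} (he₀ : Num Γ Sym d e₀)
    (he : Num Γ Sym d e) (he' : Num Γ Sym d e') :
    EmitClauses Γ d fun ρ => T.ruleClauses (e₀ ρ) (e ρ) (e' ρ) := by
  refine emitClauses_flatMap _ fun a _ => emitClauses_flatMap _ fun b _ =>
    emitClauses_flatMap _ fun c _ => emitClauses_flatMap _ fun d' _ => ?_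
  split_ifs
  · exact emitClauses_singleton (emit_imp (T.emit_is he₀ _) (emit_imp (T.emit_is he _)
      (emit_imp (T.emit_is (he.add (num_const d 1)) _) (emit_imp
        (T.emit_is (he.add (num_const d 2)) _) (T.emit_is he' _)))))
  · exact emitClauses_nil d

theorem num_rowLen {d : ℕ} {N Q B : (ℕ → ℕ) → ℕ} (hN : Num Γ Sym d N) (hQ : Num Γ Sym d Q)
    (hB : Num Γ Sym d B) : Num Γ Sym d fun ρ => rowLen (N ρ) (Q ρ) (B ρ) :=
  ((hN.add ((num_const d 2).mul hQ)).add hB).add (num_const d 2)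

theorem num_cellCount {d : ℕ} {N Q B : (ℕ → ℕ) → ℕ} (hN : Num Γ Sym d N) (hQ : Num Γ Sym d Q)
    (hB : Num Γ Sym d B) : Num Γ Sym d fun ρ => cellCount (N ρ) (Q ρ) (B ρ) :=
  ((hB.add (num_const d 1)).mul (num_rowLen hN hQ hB)).add (num_const d 1)

theorem num_certVar {d : ℕ} {N Q B : (ℕ → ℕ) → ℕ} (hN : Num Γ Sym d N) (hQ : Num Γ Sym d Q)
    (hB : Num Γ Sym d B) : Num Γ Sym d fun ρ => certVar T.vals (N ρ) (Q ρ) (B ρ) :=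
  (num_const d 1).add ((num_const d _).mul (num_cellCount hN hQ hB))

theorem num_dim {d : ℕ} {N Q B : (ℕ → ℕ) → ℕ} (hN : Num Γ Sym d N) (hQ : Num Γ Sym d Q)
    (hB : Num Γ Sym d B) : Num Γ Sym d fun ρ => dim T (N ρ) (Q ρ) (B ρ) :=
  (T.num_certVar hN hQ hB).add ((num_const d 2).mul hQ)

theorem emitClauses_clauses (q b : Polynomial ℕ) :
    EmitClauses Γ 1 fun ρ => T.clauses (ρ 0) (q.eval (ρ 0)) (b.eval (ρ 0)) := by
  have hN : ∀ d, Num Γ Sym (d + 1) fun ρ => ρ 0 := fun d => num_reg (Nat.succ_pos d)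
  have hQ := fun d => (hN d).polynomial q
  have hB := fun d => (hN d).polynomial b
  have hP := fun d => num_rowLen (hN d) (hQ d) (hB d)
  have hU := fun d => T.num_certVar (hN d) (hQ d) (hB d)
  have h₁ : Num Γ Sym 2 fun ρ => ρ 1 := num_reg (by norm_num)
  have h₁' : Num Γ Sym 3 fun ρ => ρ 1 := num_reg (by norm_num)
  have h₂' : Num Γ Sym 3 fun ρ => ρ 2 := num_reg (by norm_num)
  refine (((((?_ : EmitClauses Γ 1 _).append (?_ : EmitClauses Γ 1 _)).append
    (?_ : EmitClauses Γ 1 _)).append (?_ : EmitClauses Γ 1 _)).append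
    (?_ : EmitClauses Γ 1 _)).append ?_
  · exact (emitClauses_singleton (T.emit_is (num_const 1 0) _)).append
      (emitClauses_singleton (T.emit_is (num_const 1 1) _))
  · exact EmitClauses.flatMap_range (hQ 0) (T.emitClauses_bit
      (((num_const 2 2).add (hN 1)).add h₁) ((hU 1).add h₁) _)
  · exact EmitClauses.flatMap_range (hQ 0) (T.emitClauses_bit
      ((((num_const 2 2).add (hN 1)).add (hQ 1)).add h₁) (((hU 1).add (hQ 1)).add h₁) _)
  · exact EmitClauses.flatMap_range ((hB 0).add (num_const 1 1)) (emitClauses_singleton (T.emit_is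
      ((((num_const 2 2).add (hN 1)).add ((num_const 2 2).mul (hQ 1))).add h₁) _))
  -- In the nested loop, register `1` holds the row `t` and register `2` the position `p`; register
  -- `0` still holds the input length.
  · exact EmitClauses.flatMap_range (hB 0) (EmitClauses.flatMap_range (hP 1) (T.emitClauses_rule
      ((num_const 3 1).add (h₁'.mul (hP 2))) ((h₁'.mul (hP 2)).add h₂')
      (((num_const 3 1).add ((h₁'.add (num_const 3 1)).mul (hP 2))).add h₂')))
  · exact emitClauses_flatMap _ fun v _ => emitClauses_singleton (emit_neg (T.emit_is
      ((num_const 1 2).add ((hB 0).mul (hP 0))) v))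

/-! ### The reduction -/

/-- The instance of IN-MINTRAP as a word. -/
noncomputable def instanceWord (x : List Γ) (Q B : ℕ) : List Sym :=
  encodeInstance (fun i : Fin (dim T x.length Q B) =>
    (T.localFormula x Q B i).toProp (dim T x.length Q B)) fun _ => true

theorem varsLt_localFormula (x : List Γ) (Q B : ℕ) (i : ℕ) (hi : i < dim T x.length Q B) :
    (T.localFormula x Q B i).VarsLt (dim T x.length Q B) := by
  have h0 : 0 < dim T x.length Q B := Nat.pos_of_ne_zero (NeZero.ne _)
  rw [localFormula]
  split_ifs
  · exact ⟨h0, varsLt_formula x Q B⟩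
  · exact ⟨⟨h0, hi⟩, ⟨h0, hi⟩⟩
  · exact hi

/-- The local functions fall into four index blocks: control, tableau, first and second certificate.
Only the control's formula mentions the symbols of `x`, and its input clauses come first, so the
word has the shape required by `polyTime_of_emit`. The opening constant encodes the beginning of
`¬x₀ ∧ …`; the variable `0` has no ticks. -/
theorem instanceWord_eq (x : List Γ) (Q B : ℕ) :
    T.instanceWord x Q B = [Sym.and, Sym.neg, Sym.var] ++
      (x.zipIdx.flatMap fun a => Sym.and :: (T.is (2 + a.2) (T.sym (.inl a.1))).encode) ++
      ((T.clauses x.length Q B).flatMap (fun φ => Sym.and :: φ.encode) ++ Formula.verum.encode ++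
        ((List.range (T.vals.length * cellCount x.length Q B)).flatMap fun i =>
          (Formula.neg (.var (1 + i))).encode) ++
        ((List.range Q).flatMap fun i =>
          (Formula.xor (.var 0) (.var (certVar T.vals x.length Q B + i))).encode) ++
        ((List.range Q).flatMap fun i =>
          (Formula.neg (.var (certVar T.vals x.length Q B + Q + i))).encode) ++
        List.replicate (dim T x.length Q B) (Sym.bit true)) := by
  have h₁ : (List.ofFn fun i : Fin (dim T x.length Q B) =>
      (T.localFormula x Q B i).toProp (dim T x.length Q B)).flatMap PropFormula.encode =
      (List.range (dim T x.length Q B)).flatMap fun i => (T.localFormula x Q B i).encode := by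
    rw [List.ofFn_eq_map, ← List.map_coe_finRange_eq_range, List.flatMap_map, List.flatMap_map]
    exact List.flatMap_congr fun i _ =>
      Formula.encode_toProp (T.varsLt_localFormula x Q B i i.2)
  have hU : certVar T.vals x.length Q B = 1 + T.vals.length * cellCount x.length Q B := rfl
  have h₂ : dim T x.length Q B = 1 + T.vals.length * cellCount x.length Q B + Q + Q := by
    rw [dim, hU]; omega
  have h₃ : List.range (dim T x.length Q B) = [0] ++
      (List.range (T.vals.length * cellCount x.length Q B)).map (1 + ·) ++
      (List.range Q).map (certVar T.vals x.length Q B + ·) ++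
      (List.range Q).map (certVar T.vals x.length Q B + Q + ·) := by
    rw [h₂, List.range_add, List.range_add, List.range_add, ← hU]
    rfl
  rw [instanceWord, encodeInstance, h₁, h₃, List.ofFn_const]
  simp only [List.flatMap_append, List.flatMap_map, List.flatMap_singleton]
  have e₀ : (T.localFormula x Q B 0).encode = [Sym.and, Sym.neg, Sym.var] ++
      (x.zipIdx.flatMap fun a => Sym.and :: (T.is (2 + a.2) (T.sym (.inl a.1))).encode) ++
      (T.clauses x.length Q B).flatMap (fun φ => Sym.and :: φ.encode) ++ Formula.verum.encode := by
    rw [localFormula, if_pos rfl]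
    simp [Formula.encode, formula, Formula.encode_conj, inputClauses, List.flatMap_assoc]
  have e₁ : ((List.range (T.vals.length * cellCount x.length Q B)).flatMap fun i =>
      (T.localFormula x Q B (1 + i)).encode) =
      (List.range (T.vals.length * cellCount x.length Q B)).flatMap fun i =>
          (Formula.neg (.var (1 + i))).encode := by
    refine List.flatMap_congr fun i hi => ?_
    rw [List.mem_range] at hi
    rw [localFormula, if_neg (by omega), if_neg (by omega)]
  have e₂ : ((List.range Q).flatMap fun i =>
      (T.localFormula x Q B (certVar T.vals x.length Q B + i)).encode) =
      (List.range Q).flatMap fun i =>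
          (Formula.xor (.var 0) (.var (certVar T.vals x.length Q B + i))).encode := by
    refine List.flatMap_congr fun i hi => ?_
    rw [List.mem_range] at hi
    rw [localFormula, if_neg (by omega), if_pos (by omega)]
  have e₃ : ((List.range Q).flatMap fun i =>
      (T.localFormula x Q B (certVar T.vals x.length Q B + Q + i)).encode) =
      (List.range Q).flatMap fun i =>
          (Formula.neg (.var (certVar T.vals x.length Q B + Q + i))).encode := by
    refine List.flatMap_congr fun i hi => ?_
    rw [localFormula, if_neg (by omega), if_neg (by omega)]
  rw [e₀, e₁, e₂, e₃]
  simp only [List.append_assoc]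

theorem polyTime_instanceWord [Fintype Γ] (q b : Polynomial ℕ) :
    Nonempty (Turing.TM2ComputableInPolyTime (id : List Γ → List Γ) (id : List Sym → List Sym)
      fun x => T.instanceWord x (q.eval x.length) (b.eval x.length)) := by
  have hN : ∀ d, Num Γ Sym (d + 1) fun ρ => ρ 0 := fun d => num_reg (Nat.succ_pos d)
  have hQ := fun d => (hN d).polynomial q
  have hB := fun d => (hN d).polynomial b
  have hU := fun d => T.num_certVar (hN d) (hQ d) (hB d)
  have h₁ : Num Γ Sym 2 fun ρ => ρ 1 := num_reg (by norm_num)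
  have hin : ∀ a : Γ, Emit Γ 1 fun ρ => Sym.and :: (T.is (2 + ρ 0) (T.sym (.inl a))).encode :=
    fun a => (emit_const 1 [Sym.and]).append (T.emit_is ((num_const 1 2).add (hN 0)) _)
  have hrest := (((((Emit.append (T.emitClauses_clauses q b)
    (emit_const 1 Formula.verum.encode))).append
    (Emit.flatMap_range ((num_const 1 T.vals.length).mul (num_cellCount (hN 0) (hQ 0) (hB 0)))
      (emit_neg (emit_var ((num_const 2 1).add h₁))))).append
    (Emit.flatMap_range (hQ 0) (emit_xor (emit_var (num_const 2 0))
      (emit_var ((hU 1).add h₁))))).append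
    (Emit.flatMap_range (hQ 0) (emit_neg (emit_var (((hU 1).add (hQ 1)).add h₁))))).append
    ((T.num_dim (hN 0) (hQ 0) (hB 0)).emit (Sym.bit true))
  have := polyTime_of_emit [Sym.and, Sym.neg, Sym.var] hin hrest
  simp only [instanceWord_eq]
  exact this

end Tableau

/-- IN-MINTRAP is `Π₂ᴾ`-hard. -/
theorem isPi2PHard_inMinTrapLanguage : IsPi2PHard inMinTrapLanguage := by
  intro Γ _ A hA
  obtain ⟨R, q, hR, hRA⟩ := hA
  obtain ⟨V, vals, rule, ctl, blank, sym, acc, b, h₁, h₂, h₃, h⟩ :=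
    StackTableau.exists_tableau hR
  set T : Tableau Γ := ⟨vals.toList, rule, ctl, blank, sym, acc, by simpa using h₁,
    by simpa using h₂, by simpa using h₃⟩ with hT
  -- The machine for `R` runs on the encoded triple, of length `|x| + 2 q(|x|)`, hence the
  -- composition of `b` with `X + 2 * q`.
  refine ⟨_, T.polyTime_instanceWord q (b.comp (Polynomial.X + 2 * q)), fun x => ?_⟩
  rw [Tableau.instanceWord, encodeInstance_mem_iff, Tableau.inMinTrap_iff (R := R), hRA]
  intro u v hu hv
  have hlen : (encodeTriple (x, u, v)).length = x.length + 2 * q.eval x.length := by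
    simp [encodeTriple, hu, hv]
    omega
  obtain ⟨arr, g₁, g₂, g₃, g₄, g₅, g₆, g₇⟩ := h x u v ((b.comp (Polynomial.X + 2 * q)).eval x.length)
    (rowLen x.length (q.eval x.length) ((b.comp (Polynomial.X + 2 * q)).eval x.length))
    (by simp [hlen]) (by rw [hlen, rowLen]; omega)
  exact ⟨arr, ⟨fun j => Finset.mem_toList.2 (g₁ j), g₂, g₃, g₄, g₅, g₆⟩, g₇⟩

end TableauReduction

theorem mainTheorem2 : Complexity.IsPi2PHard BooleanNetwork.inMinTrapLanguage :=
  TableauReduction.isPi2PHard_inMinTrapLanguage
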